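/- **Théorème 11.4.** Let $k$ be a field, $F=k((\varepsilon))$ with its valuation $\mathrm{val}$, let $G$ be a connected reductive group over $k$, split with split maximal torus $T$, and $M\supset T$ a Levi subgroup of $G$. Only the (reduced) root datum $(X^*(T),\Phi,X_*(T),\Phi^\vee)$ matters; subgroups containing $T$ are given by their roots. Fix a set $\Phi_+$ of representatives of $\Phi$ modulo $\alpha\sim-\alpha$ and $\gamma\in\mathfrak t(F)=X_*(T)\otimes F$ such that, for every root $\alpha$, $\alpha(\gamma)\ne0$ and $\mathrm{val}(\alpha(\gamma))\ge 0$. Let $\ell$ be a prime, $K=\overline{\mathbb Q}_\ell$, and let $\hat T\subset\hat G$ be dual to $T,G$ over $K$, so that $\hat T(K)=\mathrm{Hom}(X_*(T),K^\times)$. *The toric variety.* For each parabolic subgroup $P\supset M$ let $a_P^{G,+}$ be the cone of the $\chi$ in the real span of $\Phi$ in $X^*(T)\otimes\mathbb R$ such that $\chi(\alpha^\vee)\ge0$ for the roots $\alpha$ of the unipotent radical of $P$ and $\chi(\alpha^\vee)=0$ for the roots of the Levi subgroup of $P$ containing $T$. These cones form a fan $\Sigma$. Let $\Sigma(1)$ be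 its set of rays and $\varpi_\sigma\in X^*(T)$ the primitive vector of a ray $\sigma$. Let $X_*(S)$ be the kernel of $X_*(T)\to\mathbb Z^{\Sigma(1)}$, $\lambda\mapsto(\varpi_\sigma(\lambda))_\sigma$, let $Cl(Y)$ be the cokernel, and fix a linear projection $\lambda\mapsto\lambda_S$ of $X_*(T)$ onto $X_*(S)$. Put $\hat S=\mathrm{Spec}\,K[X_*(S)]$. The ring $A=K[X_*(S)][y_\sigma;\sigma\in\Sigma(1)]$ is graded by $Cl(Y)$, $y_\sigma$ having as degree the class of the $\sigma$-th basis vector $D_\sigma$ and $K[X_*(S)]$ degree $0$. For $\sigma\in\Sigma$ let $A_\sigma$ be the localization of $A$ obtained by inverting the $y_\tau$ for the rays $\tau\not\subset\sigma$. The toric variety $Y$ is glued from the charts $U_\sigma=\mathrm{Spec}\,A_\sigma[0]$; there is a projection $Y\to\hat S$. If $L$ is a graded $A$-module and $D\in\mathbb Z^{\Sigma(1)}$ is a $\hat T$-invariant divisor, $L(D)$ is the module with $L(D)[D']=L[D+D']$, and $\tilde L(D)$ is the quasi-coherent sheaf on $Y$ given on $U_\sigma$ by $(L(D)\otimes_AA_\sigma)[0]$.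 *The modules.* Let $\mathcal S=\mathrm{Sym}(X_*(T)\otimes K)$, and for $\chi\in X^*(T)$ let $\partial_\chi$ be the derivation of $\mathcal S$ with $\partial_\chi(\lambda)=\langle\chi,\lambda\rangle$. For $\lambda\in X_*(T)$ put $$y_+^\lambda=\lambda_S\prod_{\varpi_\sigma(\lambda)\ge0}y_\sigma^{\varpi_\sigma(\lambda)},\qquad y_-^\lambda=\prod_{\varpi_\sigma(\lambda)<0}y_\sigma^{-\varpi_\sigma(\lambda)},$$ and for a root $\alpha$ let $R_\alpha=\sum_{d=1}^{\mathrm{val}(\alpha(\gamma))}(y_+^{\alpha^\vee}-y_-^{\alpha^\vee})^dA\otimes\ker(\partial_\alpha^d)\subset A\otimes_K\mathcal S$. If $H$ is a group dual to a connected reductive subgroup of $\hat G$ containing $\hat T$, with roots $\Phi^H\subset\Phi$ and $\Phi^H_+=\Phi_+\cap\Phi^H$, let $L^H_T=(A\otimes\mathcal S)/\sum_{\alpha\in\Phi^H_+}R_\alpha$ and let $L^H\subset L^H_T$ be the graded $A$-submodule of the elements killed by all $\partial_\chi$. For $\hat H'\subset\hat H$ the transfer factor $\Delta^H_{H'}=\prod_{\alpha\in\Phi^H_+-\Phi^{H'}_+}\partial_\alpha^{\mathrm{val}(\alpha(\gamma))}$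 induces a homogeneous map $L^H\to L^{H'}$ of degree $0$ for the $Cl(Y)$-grading. *The complex.* Let $s_M\in\hat S(K)$ and let $Y_{s_M}$ be the fibre of $Y\to\hat S$ over $s_M$. For $s\in\hat T(K)$ let $\hat G_s$ be the identity component of the centralizer of $s$ in $\hat G$ (its roots are the $\alpha^\vee$ with $\alpha^\vee(s)=1$). Let $\hat{\mathcal E}=\{\hat G_1,\dots,\hat G_n\}$ be the set of the maximal elements, for inclusion, of the finite set of the $\hat G_s$ for $s\in\hat T(K)$ above $s_M$, indexed without repetition by $[n]=\{1,\dots,n\}$. For $I\subset[n]$ let $G_I$ be the group dual to $\hat G_I=\left(\bigcap_{i\in I}\hat G_i\right)^0$, with $G_\emptyset=G$. Let $D$ be a $\hat T$-invariant divisor and let $\hat{\mathfrak F}^{G_I}(D)=\varprojlim_r\tilde L^{G_I}(D)/\mathcal J^r\tilde L^{G_I}(D)$ be the completion of $\tilde L^{G_I}(D)$ along $Y_{s_M}$, where $\mathcal J$ is the ideal sheaf of $Y_{s_M}$. Then the maps $$d\Big(\sum_{|I|=m}c_I\,e_I\Big)=\sum_{|I|=m}\ \sum_{i\in[n]}\Delta^{G_I}_{G_{I\cup\{i\}}}(c_I)\;e_i\wedge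 e_I$$ satisfy $d\circ d=0$, and the resulting complex of sheaves of abelian groups on $Y$ (whose terms are supported on $Y_{s_M}$) $$0\to\hat{\mathfrak F}^{G}(D)\to\bigoplus_{|I|=1}\hat{\mathfrak F}^{G_I}(D)\to\bigoplus_{|I|=2}\hat{\mathfrak F}^{G_I}(D)\to\cdots\to\hat{\mathfrak F}^{G_{[n]}}(D)\to0$$ is exact at every term, the two extreme ones included. -/

import Mathlib

open CategoryTheory TopologicalSpace Opposite AlgebraicGeometry
open scoped TensorProduct

universe u

noncomputable section

namespace TransferComplex

section RootData

variable {ι X Y : Type u} [AddCommGroup X] [AddCommGroup Y] (P : RootDatum ι X Y)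

/-- The index of the opposite root `-α`. -/
def neg (i : ι) : ι := P.reflectionPerm i i

/-- A system of representatives of the roots modulo `α ∼ -α`. -/
def IsHalfSystem (Φp : Set ι) : Prop :=
  ∀ i, (i ∈ Φp ∧ neg P i ∉ Φp) ∨ (i ∉ Φp ∧ neg P i ∈ Φp)

/-- The root sets of the parabolic subgroups containing `T`: such a subgroup is the subgroup
`P(μ)` attached to a cocharacter `μ` of `T`, whose roots are the `α` with `⟨α, μ⟩ ≥ 0`. -/
def IsParabolic (Ψ : Set ι) : Prop :=
  ∃ μ : Y, Ψ = {i | 0 ≤ P.toLinearMap (P.root i) μ}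

/-- The roots of the Levi subgroup (containing `T`) of a parabolic subgroup. -/
def leviRoots (Ψ : Set ι) : Set ι := {i | i ∈ Ψ ∧ neg P i ∈ Ψ}

/-- The roots of the unipotent radical of a parabolic subgroup. -/
def radicalRoots (Ψ : Set ι) : Set ι := {i | i ∈ Ψ ∧ neg P i ∉ Ψ}

/-- The root sets of the Levi subgroups containing `T`. -/
def IsLevi (ΦM : Set ι) : Prop := ∃ Ψ, IsParabolic P Ψ ∧ leviRoots P Ψ = ΦM

/-- `χ ↦ χ(α^∨)` on `X^*(T) ⊗ ℝ`. -/
def corootEval (i : ι) : ℝ ⊗[ℤ] X →ₗ[ℤ] ℝ :=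
  (TensorProduct.rid ℤ ℝ).toLinearMap ∘ₗ (P.coroot' i).lTensor ℝ

/-- The cone `a_P^{G,+}` in `X^*(T) ⊗ ℝ`. -/
def cone (Ψ : Set ι) : Set (ℝ ⊗[ℤ] X) :=
  {χ | χ ∈ Submodule.span ℝ (Set.range fun i => (1 : ℝ) ⊗ₜ[ℤ] P.root i) ∧
    (∀ i ∈ radicalRoots P Ψ, 0 ≤ corootEval P i χ) ∧
    ∀ i ∈ leviRoots P Ψ, corootEval P i χ = 0}

variable (ΦM : Set ι)

/-- The fan `Σ_M^G` of the cones `a_P^{G,+}`, for the parabolic subgroups `P` containing `M`. -/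
def fan : Set (Set (ℝ ⊗[ℤ] X)) :=
  {c | ∃ Ψ, IsParabolic P Ψ ∧ ΦM ⊆ Ψ ∧ c = cone P Ψ}

/-- The set `Σ(1)` of rays, i.e. of the cones of the fan that span a line. A ray `σ` is given
by its primitive vector `ϖ_σ`, the generator of the monoid `σ ∩ X^*(T)`. -/
def Ray : Type u :=
  {ϖ : X // ∃ σ ∈ fan P ΦM, Module.finrank ℝ (Submodule.span ℝ σ) = 1 ∧
    ∀ x : X, (1 : ℝ) ⊗ₜ[ℤ] x ∈ σ ↔ ∃ n : ℕ, x = n • ϖ}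

instance [Finite ι] : Finite (fan P ΦM) := by
  have h : (fan P ΦM) ⊆ Set.range (cone P) := by
    rintro c ⟨Ψ, -, -, rfl⟩
    exact ⟨Ψ, rfl⟩
  exact (Set.finite_range (cone P)).subset h

instance [Finite ι] [Module.Free ℤ X] : Finite (Ray P ΦM) := by
  let f : Ray P ΦM → fan P ΦM := fun ρ => ⟨ρ.2.choose, ρ.2.choose_spec.1⟩
  refine Finite.of_injective f ?_
  intro ρ ρ' h
  have hc : ρ.2.choose = ρ'.2.choose := congrArg Subtype.val h
  have h1 := ρ.2.choose_spec.2.2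
  have h2 := ρ'.2.choose_spec.2.2
  rw [hc] at h1
  have key : ∀ x : X, (∃ n : ℕ, x = n • ρ.1) ↔ ∃ n : ℕ, x = n • ρ'.1 :=
    fun x => (h1 x).symm.trans (h2 x)
  obtain ⟨n, hn⟩ := (key ρ.1).1 ⟨1, (one_smul _ _).symm⟩
  obtain ⟨m, hm⟩ := (key ρ'.1).2 ⟨1, (one_smul _ _).symm⟩
  apply Subtype.ext
  by_cases h0 : ρ.1 = 0
  · rw [h0, smul_zero] at hm
    rw [h0, hm]
  · have h3 : ((n * m : ℕ) : ℤ) • ρ.1 = (1 : ℤ) • ρ.1 := by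
      rw [one_smul, natCast_zsmul, mul_smul, ← hm, ← hn]
    have h4 := smul_left_injective ℤ h0 h3
    have h5 : n * m = 1 := by exact_mod_cast h4
    rw [hn, Nat.eq_one_of_mul_eq_one_right h5, one_smul]

/-- The homomorphism `λ ↦ (λ) = ∑ ϖ_σ(λ) D_σ` from `X_*(T)` to the group of `T̂`-invariant
divisors, which is the free abelian group on the (finite) set of rays. -/
def divisor : Y →ₗ[ℤ] (Ray P ΦM → ℤ) :=
  LinearMap.pi fun ρ => P.toLinearMap ρ.1

/-- The cocharacter group `X_*(S)`. -/
abbrev XS : Submodule ℤ Y := LinearMap.ker (divisor P ΦM)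

/-- The divisor class group `Cl(Y)`. -/
abbrev ClassGp : Type u := (Ray P ΦM → ℤ) ⧸ LinearMap.range (divisor P ΦM)

open scoped Classical in
/-- The class of the prime divisor `D_σ`. -/
def rayClass (ρ : Ray P ΦM) : ClassGp P ΦM :=
  Submodule.Quotient.mk (Pi.single ρ 1)

instance : DecidableEq (ClassGp P ΦM) := Classical.decEq _

end RootData

section Cox

variable (K : Type) [Field K]
variable {ι X Y : Type u} [AddCommGroup X] [AddCommGroup Y] (P : RootDatum ι X Y) (ΦM : Set ι)

/-- The group algebra `K[X_*(S)]`. -/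
def GroupAlg : Type u := AddMonoidAlgebra K (XS P ΦM)

instance : CommRing (GroupAlg K P ΦM) := inferInstanceAs (CommRing (AddMonoidAlgebra K (XS P ΦM)))

instance : Algebra K (GroupAlg K P ΦM) :=
  inferInstanceAs (Algebra K (AddMonoidAlgebra K (XS P ΦM)))

/-- The ring `A = K[X_*(S)][y_σ]` of homogeneous coordinates. -/
abbrev Cox : Type u := MvPolynomial (Ray P ΦM) (GroupAlg K P ΦM)

/-- The grading of `A` by `Cl(Y)`: `y_σ` has degree `[D_σ]` and `K[X_*(S)]` has degree `0`. -/
abbrev coxGrading (d : ClassGp P ΦM) : Submodule (GroupAlg K P ΦM) (Cox K P ΦM) :=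
  MvPolynomial.weightedHomogeneousSubmodule _ (rayClass P ΦM) d

instance : GradedAlgebra (coxGrading K P ΦM) :=
  MvPolynomial.weightedGradedAlgebra _ _

variable {P ΦM}

/-- The multiplicative set generated by the `y_τ`, for the rays `τ` not contained in `σ`.
Inverting it is the same as inverting the product `u_σ` of these variables. -/
def denoms (σ : fan P ΦM) : Submonoid (Cox K P ΦM) :=
  Submonoid.closure {a | ∃ ρ : Ray P ΦM, (1 : ℝ) ⊗ₜ[ℤ] ρ.1 ∉ σ.1 ∧ a = MvPolynomial.X ρ}

theorem denoms_mono {τ σ : fan P ΦM} (h : τ ≤ σ) : denoms K σ ≤ denoms K τ := by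
  apply Submonoid.closure_mono
  rintro a ⟨ρ, hρ, rfl⟩
  exact ⟨ρ, fun h' => hρ (h h'), rfl⟩

/-- The ring `A_σ[0]`, the coordinate ring of the affine chart `U_σ`. -/
abbrev ChartRing (σ : fan P ΦM) : Type u :=
  HomogeneousLocalization (coxGrading K P ΦM) (denoms K σ)

/-- The restriction of functions from `U_σ` to `U_τ`, for a face `τ` of `σ`. -/
abbrev chartRes {τ σ : fan P ΦM} (h : τ ≤ σ) : ChartRing K σ →+* ChartRing K τ :=
  HomogeneousLocalization.mapId (coxGrading K P ΦM) (denoms_mono K h)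

variable (P ΦM)

/-- The diagram of the affine charts `U_σ = Spec A_σ[0]`, with respect to inclusion of cones. -/
def chartDiagram : fan P ΦM ⥤ LocallyRingedSpace.{u} where
  obj σ := Spec.toLocallyRingedSpace.obj (op (CommRingCat.of (ChartRing K σ)))
  map f := Spec.toLocallyRingedSpace.map (CommRingCat.ofHom (chartRes K (leOfHom f))).op
  map_id σ := by
    have h : CommRingCat.ofHom (chartRes K (leOfHom (𝟙 σ))) = 𝟙 (CommRingCat.of _) :=
      CommRingCat.hom_ext (HomogeneousLocalization.map_id (coxGrading K P ΦM) (denoms K σ))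
    rw [h]
    exact Spec.toLocallyRingedSpace.map_id _
  map_comp f g := by
    have h : CommRingCat.ofHom (chartRes K (leOfHom (f ≫ g))) =
        CommRingCat.ofHom (chartRes K (leOfHom g)) ≫
          CommRingCat.ofHom (chartRes K (leOfHom f)) :=
      CommRingCat.hom_ext (HomogeneousLocalization.map_comp
        (f := .id (coxGrading K P ΦM)) (g := .id (coxGrading K P ΦM))
        (denoms_mono K (leOfHom g)) (denoms_mono K (leOfHom f)))
    rw [h, op_comp]
    exact Spec.toLocallyRingedSpace.map_comp _ _

/-- The toric variety `Y` of the fan, obtained by gluing the charts `U_σ`. -/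
def toricVariety : LocallyRingedSpace.{u} := Limits.colimit (chartDiagram K P ΦM)

variable {P ΦM}

/-- The inclusion of the chart `U_σ` in `Y`. -/
def chartIncl (σ : fan P ΦM) : (chartDiagram K P ΦM).obj σ ⟶ toricVariety K P ΦM :=
  Limits.colimit.ι (chartDiagram K P ΦM) σ

/-- The trace on the chart `U_σ` of an open subset of `Y`. -/
def chartOpen (W : Opens (toricVariety K P ΦM)) (σ : fan P ΦM) :
    Opens (PrimeSpectrum.Top (ChartRing K σ)) :=
  (Opens.map (chartIncl K σ).base).obj W

theorem chartOpen_subset (W : Opens (toricVariety K P ΦM)) {τ σ : fan P ΦM} (h : τ ≤ σ) :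
    (chartOpen K W τ).1 ⊆ PrimeSpectrum.comap (chartRes K h) ⁻¹' (chartOpen K W σ).1 := by
  intro p hp
  have hw := Limits.colimit.w (chartDiagram K P ΦM) (homOfLE h)
  have hp' : (chartIncl K τ).base p ∈ W := hp
  have e : chartIncl K τ = (chartDiagram K P ΦM).map (homOfLE h) ≫ chartIncl K σ := hw.symm
  rw [e] at hp'
  exact hp'

end Cox

section Sym

variable {K : Type} [Field K] {V : Type u} [AddCommGroup V] [Module K V]

/-- The algebra homomorphism `s ↦ s + ε ∂s` from `Sym V` to the dual numbers over `Sym V`,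
where `∂` is the derivation of `Sym V` extending the linear form `f` on `V`. -/
def symLift (f : V →ₗ[K] K) :
    SymmetricAlgebra K V →ₐ[K] TrivSqZeroExt (SymmetricAlgebra K V) (SymmetricAlgebra K V) :=
  SymmetricAlgebra.lift
    ((TrivSqZeroExt.inlAlgHom K (SymmetricAlgebra K V) (SymmetricAlgebra K V)).toLinearMap ∘ₗ
        SymmetricAlgebra.ι K V +
      ((TrivSqZeroExt.inrHom (SymmetricAlgebra K V) (SymmetricAlgebra K V)).restrictScalars K) ∘ₗ
        (Algebra.linearMap K (SymmetricAlgebra K V)) ∘ₗ f)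

theorem symLift_fst (f : V →ₗ[K] K) (s : SymmetricAlgebra K V) : (symLift f s).fst = s := by
  have h : (TrivSqZeroExt.fstHom K _ _).comp (symLift f) = AlgHom.id K _ := by
    apply SymmetricAlgebra.algHom_ext
    ext v
    simp [symLift]
  exact DFunLike.congr_fun h s

/-- The derivation of `Sym V` extending the linear form `f` on `V`. -/
def symDer (f : V →ₗ[K] K) : Derivation K (SymmetricAlgebra K V) (SymmetricAlgebra K V) :=
  Derivation.mk'
    (((TrivSqZeroExt.sndHom (SymmetricAlgebra K V) (SymmetricAlgebra K V)).restrictScalars K) ∘ₗ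
      (symLift f).toLinearMap)
    (fun a b => by simp [symLift_fst, mul_comm])

theorem symDer_ι (f : V →ₗ[K] K) (v : V) :
    symDer f (SymmetricAlgebra.ι K V v) = algebraMap K _ (f v) := by
  simp [symDer, symLift, Algebra.algebraMap_eq_smul_one]

theorem symDer_comm (f g : V →ₗ[K] K) (s : SymmetricAlgebra K V) :
    symDer f (symDer g s) = symDer g (symDer f s) := by
  have h : ⁅symDer f, symDer g⁆ s = 0 := by
    induction s using SymmetricAlgebra.induction with
    | algebraMap r => simp
    | ι x => simp [Derivation.commutator_apply, symDer_ι]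
    | mul a b ha hb => rw [Derivation.leibniz, ha, hb]; simp
    | add a b ha hb => rw [map_add, ha, hb, add_zero]
  rw [Derivation.commutator_apply] at h
  exact sub_eq_zero.1 h

end Sym

section Modules

variable (K : Type) [Field K]
variable {ι X Y : Type u} [AddCommGroup X] [AddCommGroup Y] (P : RootDatum ι X Y)

/-- The algebra `𝒮 = Sym(X_*(T) ⊗ K)`. -/
def SymT (Y : Type u) [AddCommGroup Y] : Type u := SymmetricAlgebra K (K ⊗[ℤ] Y)

instance : CommRing (SymT K Y) := inferInstanceAs (CommRing (SymmetricAlgebra K (K ⊗[ℤ] Y)))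

instance : Algebra K (SymT K Y) := inferInstanceAs (Algebra K (SymmetricAlgebra K (K ⊗[ℤ] Y)))

/-- The derivation `∂_χ` of `𝒮`, with `∂_χ(λ) = ⟨χ, λ⟩` for `λ ∈ X_*(T)`. -/
def der (χ : X) : Derivation K (SymT K Y) (SymT K Y) :=
  symDer ((TensorProduct.AlgebraTensorModule.rid ℤ K K).toLinearMap ∘ₗ
    (P.toLinearMap χ).baseChange K)

/-- `∂_χ` as a linear operator. -/
def derEnd (χ : X) : Module.End K (SymT K Y) := (der K P χ).toLinearMap

theorem derEnd_commute (χ ψ : X) : Commute (derEnd K P χ) (derEnd K P ψ) :=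
  LinearMap.ext fun s => symDer_comm _ _ s

theorem derEnd_pow_commute (v : ι → ℕ) (i j : ι) :
    Commute (derEnd K P (P.root i) ^ v i) (derEnd K P (P.root j) ^ v j) :=
  (derEnd_commute K P _ _).pow_pow _ _

variable [Finite ι]

/-- The transfer factor `Δ_{H'}^H = ∏ ∂_α ^ {v(α)}`, the product being over the roots `α` in
`Φ_+^H - Φ_+^{H'}`; here `v(α)` stands for `val(α(γ))`. -/
def transfer (v : ι → ℕ) (Φp H H' : Set ι) : Module.End K (SymT K Y) :=
  (Set.toFinite ((Φp ∩ H) \ (Φp ∩ H'))).toFinset.noncommProd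
    (fun i => derEnd K P (P.root i) ^ v i) (fun i _ j _ _ => derEnd_pow_commute K P v i j)

theorem derEnd_commute_transfer (v : ι → ℕ) (Φp H H' : Set ι) (χ : X) :
    Commute (derEnd K P χ) (transfer K P v Φp H H') :=
  Finset.noncommProd_commute _ _ _ _ fun _ _ => (derEnd_commute K P _ _).pow_right _

theorem transfer_factor (v : ι → ℕ) {Φp H H' : Set ι} {i : ι} (hi : i ∈ Φp ∩ H)
    (hi' : i ∉ H') : ∃ E : Module.End K (SymT K Y),
      transfer K P v Φp H H' = E * derEnd K P (P.root i) ^ v i := by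
  classical
  have hm : i ∈ (Set.toFinite ((Φp ∩ H) \ (Φp ∩ H'))).toFinset := by
    simpa using ⟨hi, fun _ => hi'⟩
  exact ⟨_, (Finset.noncommProd_erase_mul _ hm _ _).symm⟩

variable [Module.Free ℤ X] {P} {ΦM : Set ι} (pr : Y →ₗ[ℤ] XS P ΦM)

/-- The element `y_+^λ = λ_S ∏_{ϖ_σ(λ) ≥ 0} y_σ ^ {ϖ_σ(λ)}` of `A`, where `λ_S = pr λ`. -/
def yPlus (l : Y) : Cox K P ΦM :=
  MvPolynomial.monomial
    (Finsupp.equivFunOnFinite.symm fun ρ : Ray P ΦM => (P.toLinearMap ρ.1 l).toNat)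
    (AddMonoidAlgebra.single (pr l) 1 : AddMonoidAlgebra K (XS P ΦM))

variable (P ΦM) in
/-- The element `y_-^λ = ∏_{ϖ_σ(λ) < 0} y_σ ^ {-ϖ_σ(λ)}` of `A`. -/
def yMinus (l : Y) : Cox K P ΦM :=
  MvPolynomial.monomial
    (Finsupp.equivFunOnFinite.symm fun ρ : Ray P ΦM => (-P.toLinearMap ρ.1 l).toNat) 1

/-- The submodule `R_α = ∑_{d=1}^{v(α)} (y_+^{α^∨} - y_-^{α^∨})^d A ⊗ ker ∂_α^d` of `A ⊗ 𝒮`. -/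
def rootSubmodule (v : ι → ℕ) (i : ι) : Submodule (Cox K P ΦM) (Cox K P ΦM ⊗[K] SymT K Y) :=
  ⨆ d ∈ Finset.Icc 1 (v i), Submodule.span (Cox K P ΦM)
    {t | ∃ s : SymT K Y, (derEnd K P (P.root i) ^ d) s = 0 ∧
      t = ((yPlus K pr (P.coroot i) - yMinus K P ΦM (P.coroot i)) ^ d) ⊗ₜ[K] s}

theorem rootSubmodule_le_comap (v : ι → ℕ) (i : ι) (E : Module.End K (SymT K Y))
    (hE : Commute (derEnd K P (P.root i)) E) :
    rootSubmodule K pr v i ≤ (rootSubmodule K pr v i).comap (E.baseChange (Cox K P ΦM)) := by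
  refine iSup₂_le fun d hd => Submodule.span_le.2 ?_
  rintro _ ⟨s, hs, rfl⟩
  refine Submodule.mem_iSup_of_mem d (Submodule.mem_iSup_of_mem hd
    (Submodule.subset_span ⟨E s, ?_, ?_⟩))
  · have h := (hE.pow_left d).eq
    calc (derEnd K P (P.root i) ^ d) (E s) = ((derEnd K P (P.root i) ^ d) * E) s := rfl
      _ = E ((derEnd K P (P.root i) ^ d) s) := by rw [h]; rfl
      _ = 0 := by rw [hs, map_zero]
  · simp

theorem rootSubmodule_le_ker (v : ι → ℕ) (i : ι) (E : Module.End K (SymT K Y)) :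
    rootSubmodule K pr v i ≤ LinearMap.ker
      ((E * derEnd K P (P.root i) ^ v i).baseChange (Cox K P ΦM)) := by
  refine iSup₂_le fun d hd => Submodule.span_le.2 ?_
  rintro _ ⟨s, hs, rfl⟩
  obtain ⟨c, hc⟩ := Nat.exists_eq_add_of_le (Finset.mem_Icc.1 hd).2
  have : (derEnd K P (P.root i) ^ v i) s = 0 := by
    rw [hc, add_comm, pow_add, Module.End.mul_apply, hs, map_zero]
  simp [this]

/-- The submodule `∑_{α ∈ Φ_+^H} R_α` of `A ⊗ 𝒮`. -/
def relations (v : ι → ℕ) (Φp H : Set ι) :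
    Submodule (Cox K P ΦM) (Cox K P ΦM ⊗[K] SymT K Y) :=
  ⨆ i ∈ Φp ∩ H, rootSubmodule K pr v i

theorem relations_le_comap_der (v : ι → ℕ) (Φp H : Set ι) (χ : X) :
    relations K pr v Φp H ≤
      (relations K pr v Φp H).comap ((derEnd K P χ).baseChange (Cox K P ΦM)) := by
  refine iSup₂_le fun i hi => ?_
  refine (rootSubmodule_le_comap K pr v i (derEnd K P χ) (derEnd_commute K P _ χ)).trans ?_
  exact Submodule.comap_mono (le_iSup₂_of_le (f := fun i _ => rootSubmodule K pr v i) i hi le_rfl)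

theorem relations_le_comap_transfer (v : ι → ℕ) (Φp H H' : Set ι) :
    relations K pr v Φp H ≤ (relations K pr v Φp H').comap
      ((transfer K P v Φp H H').baseChange (Cox K P ΦM)) := by
  refine iSup₂_le fun i hi => ?_
  by_cases hi' : i ∈ H'
  · refine (rootSubmodule_le_comap K pr v i (transfer K P v Φp H H')
      (derEnd_commute_transfer K P v Φp H H' _)).trans ?_
    exact Submodule.comap_mono
      (le_iSup₂_of_le (f := fun i _ => rootSubmodule K pr v i) i ⟨hi.1, hi'⟩ le_rfl)
  · obtain ⟨E, hE⟩ := transfer_factor K P v hi hi'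
    rw [hE]
    exact (rootSubmodule_le_ker K pr v i E).trans (LinearMap.ker_le_comap _)

/-- The `A`-module `L_T^H = A ⊗ 𝒮 / ∑_{α ∈ Φ_+^H} R_α`. -/
abbrev LT (v : ι → ℕ) (Φp H : Set ι) : Type u :=
  (Cox K P ΦM ⊗[K] SymT K Y) ⧸ relations K pr v Φp H

/-- The action of `∂_χ` on `L_T^H`. -/
def derLT (v : ι → ℕ) (Φp H : Set ι) (χ : X) :
    LT K pr v Φp H →ₗ[Cox K P ΦM] LT K pr v Φp H :=
  Submodule.mapQ _ _ ((derEnd K P χ).baseChange (Cox K P ΦM))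
    (relations_le_comap_der K pr v Φp H χ)

/-- The submodule `L^H = L_T^H{𝒟⁺}` of the elements killed by the augmentation ideal `𝒟⁺` of
`𝒟 = Sym(X^*(T) ⊗ K)`, i.e. by its generators `∂_χ` for `χ ∈ X^*(T)`. -/
def LH (v : ι → ℕ) (Φp H : Set ι) : Submodule (Cox K P ΦM) (LT K pr v Φp H) :=
  ⨅ χ : X, LinearMap.ker (derLT K pr v Φp H χ)

/-- The part of degree `e ∈ Cl(Y)` of `L^H`. -/
def gradedPiece (v : ι → ℕ) (Φp H : Set ι) (e : ClassGp P ΦM) :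
    AddSubgroup (LH K pr v Φp H) :=
  ((AddSubgroup.closure {t : Cox K P ΦM ⊗[K] SymT K Y | ∃ a ∈ coxGrading K P ΦM e,
      ∃ s : SymT K Y, t = a ⊗ₜ[K] s}).map
    (relations K pr v Φp H).mkQ.toAddMonoidHom).comap (LH K pr v Φp H).subtype.toAddMonoidHom

theorem smul_mem_gradedPiece {v : ι → ℕ} {Φp H : Set ι} {e e' : ClassGp P ΦM} {a : Cox K P ΦM}
    (ha : a ∈ coxGrading K P ΦM e') {m : LH K pr v Φp H} (hm : m ∈ gradedPiece K pr v Φp H e) :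
    a • m ∈ gradedPiece K pr v Φp H (e' + e) := by
  obtain ⟨t, ht, hm⟩ := hm
  refine ⟨a • t, ?_, ?_⟩
  · clear hm
    induction ht using AddSubgroup.closure_induction with
    | mem t h =>
      obtain ⟨b, hb, s, rfl⟩ := h
      exact AddSubgroup.subset_closure ⟨a * b, SetLike.mul_mem_graded ha hb, s, by
        rw [TensorProduct.smul_tmul', smul_eq_mul]⟩
    | zero => rw [smul_zero]; exact zero_mem _
    | add x y _ _ hx hy => rw [smul_add]; exact add_mem hx hy
    | neg x _ hx => rw [smul_neg]; exact neg_mem hx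
  · change (relations K pr v Φp H).mkQ (a • t) = a • (m : LT K pr v Φp H)
    rw [map_smul]
    exact congrArg (a • ·) hm

/-- The map `L_T^H → L_T^{H'}` induced by the transfer factor. -/
def transferLT (v : ι → ℕ) (Φp H H' : Set ι) :
    LT K pr v Φp H →ₗ[Cox K P ΦM] LT K pr v Φp H' :=
  Submodule.mapQ _ _ ((transfer K P v Φp H H').baseChange (Cox K P ΦM))
    (relations_le_comap_transfer K pr v Φp H H')

theorem derLT_transferLT (v : ι → ℕ) (Φp H H' : Set ι) (χ : X) (x : LT K pr v Φp H) :
    derLT K pr v Φp H' χ (transferLT K pr v Φp H H' x) =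
      transferLT K pr v Φp H H' (derLT K pr v Φp H χ x) := by
  obtain ⟨t, rfl⟩ := Submodule.Quotient.mk_surjective _ x
  have h := (derEnd_commute_transfer K P v Φp H H' χ).eq
  change Submodule.Quotient.mk (((derEnd K P χ).baseChange (Cox K P ΦM))
      ((transfer K P v Φp H H').baseChange (Cox K P ΦM) t)) =
    Submodule.Quotient.mk ((transfer K P v Φp H H').baseChange (Cox K P ΦM)
      ((derEnd K P χ).baseChange (Cox K P ΦM) t))
  rw [← LinearMap.comp_apply, ← LinearMap.comp_apply, ← LinearMap.baseChange_comp,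
    ← LinearMap.baseChange_comp]
  exact congrArg (fun E : Module.End K (SymT K Y) =>
    (Submodule.Quotient.mk (E.baseChange (Cox K P ΦM) t) : LT K pr v Φp H')) h

/-- The map `L^H → L^{H'}` induced by the transfer factor. -/
def transferLH (v : ι → ℕ) (Φp H H' : Set ι) :
    LH K pr v Φp H →ₗ[Cox K P ΦM] LH K pr v Φp H' :=
  (transferLT K pr v Φp H H').restrict fun x hx => by
    refine (Submodule.mem_iInf _).2 fun χ => ?_
    rw [LinearMap.mem_ker, derLT_transferLT,
      LinearMap.mem_ker.1 ((Submodule.mem_iInf _).1 hx χ), map_zero]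

theorem transferLH_mem {v : ι → ℕ} {Φp H H' : Set ι} {e : ClassGp P ΦM}
    {m : LH K pr v Φp H} (hm : m ∈ gradedPiece K pr v Φp H e) :
    transferLH K pr v Φp H H' m ∈ gradedPiece K pr v Φp H' e := by
  obtain ⟨t, ht, hm⟩ := hm
  refine ⟨(transfer K P v Φp H H').baseChange (Cox K P ΦM) t, ?_, ?_⟩
  · clear hm
    induction ht using AddSubgroup.closure_induction with
    | mem t h =>
      obtain ⟨b, hb, s, rfl⟩ := h
      exact AddSubgroup.subset_closure ⟨b, hb, _, LinearMap.baseChange_tmul _ _ _⟩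
    | zero => rw [map_zero]; exact zero_mem _
    | add x y _ _ hx hy => rw [map_add]; exact add_mem hx hy
    | neg x _ hx => rw [map_neg]; exact neg_mem hx
  · change transferLT K pr v Φp H H' ((relations K pr v Φp H).mkQ t) =
      transferLT K pr v Φp H H' (m : LT K pr v Φp H)
    exact congrArg _ hm

end Modules

section Sheaves

variable (K : Type) [Field K]
variable {ι X Y : Type u} [AddCommGroup X] [AddCommGroup Y] {P : RootDatum ι X Y} {ΦM : Set ι}
variable {M M' : Type u} [AddCommGroup M] [Module (Cox K P ΦM) M]
variable [AddCommGroup M'] [Module (Cox K P ΦM) M']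

instance (σ : fan P ΦM) : Module (ChartRing K σ) (LocalizedModule (denoms K σ) M) :=
  Module.compHom _ (algebraMap (ChartRing K σ) (Localization (denoms K σ)))

theorem mk_smul_mk (σ : fan P ΦM) (c : HomogeneousLocalization.NumDenSameDeg
    (coxGrading K P ΦM) (denoms K σ)) (m : M) (f : denoms K σ) :
    (HomogeneousLocalization.mk c : ChartRing K σ) • LocalizedModule.mk m f =
      LocalizedModule.mk ((c.num : Cox K P ΦM) • m) (⟨c.den, c.den_mem⟩ * f) :=
  LocalizedModule.mk_smul_mk _ _ _ _

theorem liftOfLE_mk {τ σ : fan P ΦM} (h : τ ≤ σ) (m : M) (f : denoms K σ) :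
    LocalizedModule.liftOfLE _ _ (denoms_mono K h) (LocalizedModule.mk m f) =
      LocalizedModule.mk m (⟨f.1, denoms_mono K h f.2⟩ : denoms K τ) := by
  simpa only [IsLocalizedModule.mk_eq_mk'] using IsLocalizedModule.liftOfLE_mk' (denoms K σ)
    (denoms K τ) (denoms_mono K h) (LocalizedModule.mkLinearMap (denoms K σ) M)
    (LocalizedModule.mkLinearMap (denoms K τ) M) m f

variable (gr : ClassGp P ΦM → AddSubgroup M) [SetLike.GradedSMul (coxGrading K P ΦM) gr]
variable (gr' : ClassGp P ΦM → AddSubgroup M') [SetLike.GradedSMul (coxGrading K P ΦM) gr']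

/-- The `A_σ[0]`-module `(M(D) ⊗ A_σ)[0]` attached to a graded `A`-module `M` and to the class
`c` of a divisor `D`: it consists of the fractions `m / f` with `deg m = c + deg f`. -/
def chartModule (c : ClassGp P ΦM) (σ : fan P ΦM) :
    Submodule (ChartRing K σ) (LocalizedModule (denoms K σ) M) where
  carrier := {x | ∃ e : ClassGp P ΦM, ∃ f : denoms K σ, (f : Cox K P ΦM) ∈ coxGrading K P ΦM e ∧
    ∃ m ∈ gr (c + e), x = LocalizedModule.mk m f}
  zero_mem' := ⟨0, 1, SetLike.GradedOne.one_mem, 0, zero_mem _, (LocalizedModule.zero_mk _).symm⟩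
  add_mem' := by
    rintro _ _ ⟨e, f, hf, m, hm, rfl⟩ ⟨e', f', hf', m', hm', rfl⟩
    refine ⟨e + e', f * f', SetLike.GradedMul.mul_mem hf hf', f' • m + f • m', ?_,
      LocalizedModule.mk_add_mk⟩
    refine add_mem ?_ ?_
    · have h := SetLike.GradedSMul.smul_mem hf' hm
      rwa [vadd_eq_add, show e' + (c + e) = c + (e + e') by abel] at h
    · have h := SetLike.GradedSMul.smul_mem hf hm'
      rwa [vadd_eq_add, show e + (c + e') = c + (e + e') by abel] at h
  smul_mem' := by
    rintro z _ ⟨e, f, hf, m, hm, rfl⟩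
    obtain ⟨q, rfl⟩ := HomogeneousLocalization.mk_surjective z
    refine ⟨q.deg + e, ⟨q.den, q.den_mem⟩ * f, SetLike.GradedMul.mul_mem q.den.2 hf,
      (q.num : Cox K P ΦM) • m, ?_, mk_smul_mk K σ q m f⟩
    have h := SetLike.GradedSMul.smul_mem q.num.2 hm
    rwa [vadd_eq_add, show q.deg + (c + e) = c + (q.deg + e) by abel] at h

/-- The restriction from the chart `U_σ` to the chart `U_τ`, for a face `τ` of `σ`. -/
def chartModuleRes (c : ClassGp P ΦM) {τ σ : fan P ΦM} (h : τ ≤ σ) :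
    chartModule K gr c σ →ₛₗ[chartRes K h] chartModule K gr c τ where
  toFun x := ⟨LocalizedModule.liftOfLE _ _ (denoms_mono K h) x.1, by
    obtain ⟨_, e, f, hf, m, hm, rfl⟩ := x
    exact ⟨e, ⟨f, denoms_mono K h f.2⟩, hf, m, hm, liftOfLE_mk K h m f⟩⟩
  map_add' x y := Subtype.ext (map_add _ _ _)
  map_smul' z x := by
    obtain ⟨x, e, f, hf, m, hm, rfl⟩ := x
    obtain ⟨q, rfl⟩ := HomogeneousLocalization.mk_surjective z
    apply Subtype.ext
    change LocalizedModule.liftOfLE _ _ (denoms_mono K h) (HomogeneousLocalization.mk q •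
      LocalizedModule.mk m f) = chartRes K h (HomogeneousLocalization.mk q) •
        LocalizedModule.liftOfLE _ _ (denoms_mono K h) (LocalizedModule.mk m f)
    rw [mk_smul_mk, liftOfLE_mk K h, liftOfLE_mk K h]
    exact (mk_smul_mk K τ ⟨q.deg, q.num, q.den, denoms_mono K h q.den_mem⟩ m
      ⟨f, denoms_mono K h f.2⟩).symm

variable {gr gr'}

/-- The map on charts induced by a homogeneous map `M → M'` of degree `0`. -/
def chartModuleMap (c : ClassGp P ΦM) (σ : fan P ΦM) (g : M →ₗ[Cox K P ΦM] M')
    (hg : ∀ e, ∀ m ∈ gr e, g m ∈ gr' e) :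
    chartModule K gr c σ →ₗ[ChartRing K σ] chartModule K gr' c σ where
  toFun x := ⟨LocalizedModule.map (denoms K σ) g x.1, by
    obtain ⟨_, e, f, hf, m, hm, rfl⟩ := x
    exact ⟨e, f, hf, g m, hg _ _ hm, LocalizedModule.map_mk _ _ _ _⟩⟩
  map_add' x y := Subtype.ext (map_add _ _ _)
  map_smul' z x := Subtype.ext
    ((LocalizedModule.map (denoms K σ) g).map_smul (algebraMap _ (Localization (denoms K σ)) z) x.1)

end Sheaves

section Completion

variable (K : Type) [Field K]
variable {ι X Y : Type u} [AddCommGroup X] [AddCommGroup Y] {P : RootDatum ι X Y} {ΦM : Set ι}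

/-- Evaluation of functions on `Ŝ = Spec K[X_*(S)]` at a point `s_M`. -/
def evalS (sM : Multiplicative (XS P ΦM) →* Kˣ) : GroupAlg K P ΦM →+* K :=
  (AddMonoidAlgebra.lift K K (XS P ΦM) ((Units.coeHom K).comp sM)).toRingHom

theorem C_mem (a : GroupAlg K P ΦM) :
    (MvPolynomial.C a : Cox K P ΦM) ∈ coxGrading K P ΦM 0 :=
  MvPolynomial.isWeightedHomogeneous_C _ _

/-- The homomorphism `K[X_*(S)] → A[0]`. -/
def constHom : GroupAlg K P ΦM →+* coxGrading K P ΦM 0 where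
  toFun a := ⟨MvPolynomial.C a, C_mem K a⟩
  map_one' := Subtype.ext (map_one MvPolynomial.C)
  map_zero' := Subtype.ext (map_zero MvPolynomial.C)
  map_mul' a b := Subtype.ext (map_mul MvPolynomial.C a b)
  map_add' a b := Subtype.ext (map_add MvPolynomial.C a b)

/-- The homomorphism `K[X_*(S)] → A_σ[0]`, which gives the projection `U_σ → Ŝ`. -/
def chartProj (σ : fan P ΦM) : GroupAlg K P ΦM →+* ChartRing K σ :=
  (HomogeneousLocalization.fromZeroRingHom (coxGrading K P ΦM) (denoms K σ)).comp (constHom K)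

theorem chartRes_chartProj {τ σ : fan P ΦM} (h : τ ≤ σ) (a : GroupAlg K P ΦM) :
    chartRes K h (chartProj K σ a) = chartProj K τ a := rfl

variable {K} in
/-- The ideal of `A_σ[0]` which defines the fibre `Y_{s_M}` of `Y → Ŝ` over `s_M`. -/
def fibreIdeal (sM : Multiplicative (XS P ΦM) →* Kˣ) (σ : fan P ΦM) : Ideal (ChartRing K σ) :=
  (RingHom.ker (evalS K sM)).map (chartProj K σ)

variable {K} in
theorem fibreIdeal_map (sM : Multiplicative (XS P ΦM) →* Kˣ) {τ σ : fan P ΦM} (h : τ ≤ σ) :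
    (fibreIdeal sM σ).map (chartRes K h) ≤ fibreIdeal sM τ := by
  rw [fibreIdeal, Ideal.map_map]
  exact le_rfl

theorem pow_smul_top_le_comap {R S N N' : Type*} [CommRing R] [CommRing S] [AddCommGroup N]
    [Module R N] [AddCommGroup N'] [Module S N'] {φ : R →+* S} (f : N →ₛₗ[φ] N') {I : Ideal R}
    {J : Ideal S} (h : I.map φ ≤ J) (n : ℕ) :
    (I ^ n • ⊤ : Submodule R N) ≤ (J ^ n • ⊤ : Submodule S N').comap f := by
  refine Submodule.smul_le.2 fun r hr x _ => ?_
  rw [Submodule.mem_comap, map_smulₛₗ]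
  refine Submodule.smul_mem_smul ?_ trivial
  have h1 : φ r ∈ (I ^ n).map φ := Ideal.mem_map_of_mem _ hr
  rw [Ideal.map_pow] at h1
  exact Ideal.pow_right_mono h n h1

variable {M M' : Type u} [AddCommGroup M] [Module (Cox K P ΦM) M]
variable [AddCommGroup M'] [Module (Cox K P ΦM) M']
variable (gr : ClassGp P ΦM → AddSubgroup M) [SetLike.GradedSMul (coxGrading K P ΦM) gr]
variable (gr' : ClassGp P ΦM → AddSubgroup M') [SetLike.GradedSMul (coxGrading K P ΦM) gr']
variable {K} (sM : Multiplicative (XS P ΦM) →* Kˣ) (c : ClassGp P ΦM)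

/-- The reduction of `chartModule` modulo the `n`-th power of the ideal of the fibre. -/
abbrev Trunc (n : ℕ) (σ : fan P ΦM) : Type u :=
  chartModule K gr c σ ⧸ (fibreIdeal sM σ ^ n • ⊤ : Submodule (ChartRing K σ) (chartModule K gr c σ))

/-- The transition map from the reduction modulo the power `n + 1` to that modulo the power `n`. -/
def truncStep (n : ℕ) (σ : fan P ΦM) :
    Trunc gr sM c (n + 1) σ →ₗ[ChartRing K σ] Trunc gr sM c n σ :=
  Submodule.factor (Submodule.smul_mono_left (Ideal.pow_le_pow_right n.le_succ))

/-- The restriction of the reductions from `U_σ` to `U_τ`. -/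
def truncRes (n : ℕ) {τ σ : fan P ΦM} (h : τ ≤ σ) :
    Trunc gr sM c n σ →ₛₗ[chartRes K h] Trunc gr sM c n τ :=
  Submodule.mapQ _ _ (chartModuleRes K gr c h)
    (pow_smul_top_le_comap _ (fibreIdeal_map sM h) n)

variable {gr gr'}

/-- The map on the reductions induced by a homogeneous map of degree `0`. -/
def truncMap (n : ℕ) (σ : fan P ΦM) (g : M →ₗ[Cox K P ΦM] M')
    (hg : ∀ e, ∀ m ∈ gr e, g m ∈ gr' e) :
    Trunc gr sM c n σ →ₗ[ChartRing K σ] Trunc gr' sM c n σ :=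
  Submodule.mapQ _ _ (chartModuleMap K c σ g hg)
    (pow_smul_top_le_comap _ (Ideal.map_id _).le n)

variable (gr)

/-- The sections over an open subset `W ∩ U_σ` of `U_σ` of the quasi-coherent sheaf attached to
the reduction `Trunc`. -/
abbrev ChartSections (W : Opens (toricVariety K P ΦM)) (n : ℕ) (σ : fan P ΦM) : Type u :=
  (structureSheafInType (ChartRing K σ) (Trunc gr sM c n σ)).obj.obj
    (op (chartOpen K W σ))

/-- `truncStep` on sections. -/
def sectStep (W : Opens (toricVariety K P ΦM)) (n : ℕ) (σ : fan P ΦM) :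
    ChartSections gr sM c W (n + 1) σ →ₗ[ChartRing K σ] ChartSections gr sM c W n σ :=
  StructureSheaf.comapₗ (truncStep gr sM c n σ) _ _ fun _ h => h

/-- `truncRes` on sections. -/
def sectRes (W : Opens (toricVariety K P ΦM)) (n : ℕ) {τ σ : fan P ΦM} (h : τ ≤ σ) :
    ChartSections gr sM c W n σ →ₛₗ[chartRes K h] ChartSections gr sM c W n τ :=
  StructureSheaf.comapₗ (truncRes gr sM c n h) _ _ (chartOpen_subset K W h)

variable {gr}

/-- `truncMap` on sections. -/
def sectMap (W : Opens (toricVariety K P ΦM)) (n : ℕ) (σ : fan P ΦM) (g : M →ₗ[Cox K P ΦM] M')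
    (hg : ∀ e, ∀ m ∈ gr e, g m ∈ gr' e) :
    ChartSections gr sM c W n σ →ₗ[ChartRing K σ] ChartSections gr' sM c W n σ :=
  StructureSheaf.comapₗ (truncMap sM c n σ g hg) _ _ fun _ h => h

variable (gr)

/-- The sections over `W` of the completion, along the fibre `Y_{s_M}`, of the quasi-coherent
sheaf `M̃(D)` on `Y`, i.e. of the limit over `n` of the quotients of `M̃(D)` by `𝓙 ^ n`, where `𝓙`
is the ideal of the fibre. A section of such a quotient is a family of sections on the charts
which are compatible with restriction. -/
def completedSections (W : Opens (toricVariety K P ΦM)) :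
    AddSubgroup (∀ n σ, ChartSections gr sM c W n σ) where
  carrier := {s | (∀ n σ, sectStep gr sM c W n σ (s (n + 1) σ) = s n σ) ∧
    ∀ n (τ σ : fan P ΦM) (h : τ ≤ σ), sectRes gr sM c W n h (s n σ) = s n τ}
  zero_mem' := ⟨fun _ _ => map_zero _, fun _ _ _ _ => map_zero _⟩
  add_mem' := fun hs ht => ⟨fun n σ => (map_add _ _ _).trans (congrArg₂ _ (hs.1 n σ) (ht.1 n σ)),
    fun n τ σ h => (map_add _ _ _).trans (congrArg₂ _ (hs.2 n τ σ h) (ht.2 n τ σ h))⟩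
  neg_mem' := fun hs => ⟨fun n σ => (map_neg _ _).trans (congrArg _ (hs.1 n σ)),
    fun n τ σ h => (map_neg _ _).trans (congrArg _ (hs.2 n τ σ h))⟩

open StructureSheaf in
theorem comap_square {R S N N' L L' : Type u} [CommRing R] [CommRing S] [AddCommGroup N]
    [Module R N] [AddCommGroup N'] [Module R N'] [AddCommGroup L] [Module S L] [AddCommGroup L']
    [Module S L'] {φ : R →+* S} (f : N →ₗ[R] N') (f' : L →ₗ[S] L') (r : N →ₛₗ[φ] L)
    (r' : N' →ₛₗ[φ] L') (h : ∀ m, r' (f m) = f' (r m)) (U : Opens (PrimeSpectrum.Top R))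
    (V : Opens (PrimeSpectrum.Top S)) (hUV : V.1 ⊆ PrimeSpectrum.comap φ ⁻¹' U.1)
    (s : (structureSheafInType R N).obj.obj (op U)) :
    comapₗ r' U V hUV (comapₗ f U U (fun _ h => h) s) =
      comapₗ f' V V (fun _ h => h) (comapₗ r U V hUV s) := by
  refine Subtype.ext (funext fun p => ?_)
  change Localizations.comapFun r' p.1 (Localizations.comapFun f _ (s.1 ⟨_, hUV p.2⟩)) =
    Localizations.comapFun f' p.1 (Localizations.comapFun r p.1 (s.1 ⟨_, hUV p.2⟩))
  generalize s.1 ⟨_, hUV p.2⟩ = x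
  induction x using LocalizedModule.induction_on with
  | h m t =>
    erw [Localizations.comapFun_mk, Localizations.comapFun_mk, Localizations.comapFun_mk,
      Localizations.comapFun_mk, h]
    rfl

variable {gr}

theorem truncMap_step (n : ℕ) (σ : fan P ΦM) (g : M →ₗ[Cox K P ΦM] M')
    (hg : ∀ e, ∀ m ∈ gr e, g m ∈ gr' e) (x : Trunc gr sM c (n + 1) σ) :
    truncStep gr' sM c n σ (truncMap sM c (n + 1) σ g hg x) =
      truncMap sM c n σ g hg (truncStep gr sM c n σ x) := by
  obtain ⟨x, rfl⟩ := Submodule.Quotient.mk_surjective _ x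
  rfl

theorem truncMap_res (n : ℕ) {τ σ : fan P ΦM} (h : τ ≤ σ) (g : M →ₗ[Cox K P ΦM] M')
    (hg : ∀ e, ∀ m ∈ gr e, g m ∈ gr' e) (x : Trunc gr sM c n σ) :
    truncRes gr' sM c n h (truncMap sM c n σ g hg x) =
      truncMap sM c n τ g hg (truncRes gr sM c n h x) := by
  obtain ⟨⟨_, e, f, hf, m, hm, rfl⟩, rfl⟩ := Submodule.Quotient.mk_surjective _ x
  refine congrArg Submodule.Quotient.mk (Subtype.ext ?_)
  change LocalizedModule.liftOfLE _ _ (denoms_mono K h) (LocalizedModule.map (denoms K σ) g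
    (LocalizedModule.mk m f)) = LocalizedModule.map (denoms K τ) g
      (LocalizedModule.liftOfLE _ _ (denoms_mono K h) (LocalizedModule.mk m f))
  rw [LocalizedModule.map_mk, liftOfLE_mk K h, liftOfLE_mk K h, LocalizedModule.map_mk]

/-- The map on sections of the completions induced by a homogeneous map of degree `0`. -/
def completedMap (W : Opens (toricVariety K P ΦM)) (g : M →ₗ[Cox K P ΦM] M')
    (hg : ∀ e, ∀ m ∈ gr e, g m ∈ gr' e) :
    completedSections gr sM c W →+ completedSections gr' sM c W where
  toFun s := ⟨fun n σ => sectMap sM c W n σ g hg (s.1 n σ),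
    fun n σ => by
      have h := comap_square (truncMap sM c (n + 1) σ g hg) (truncMap sM c n σ g hg)
        (truncStep gr sM c n σ) (truncStep gr' sM c n σ) (truncMap_step sM c n σ g hg)
        _ _ (fun _ h => h) (s.1 (n + 1) σ)
      exact h.trans (congrArg _ (s.2.1 n σ)),
    fun n τ σ hτ => by
      have h := comap_square (truncMap sM c n σ g hg) (truncMap sM c n τ g hg)
        (truncRes gr sM c n hτ) (truncRes gr' sM c n hτ) (truncMap_res sM c n hτ g hg)
        _ _ (chartOpen_subset K W hτ) (s.1 n σ)
      exact h.trans (congrArg _ (s.2.2 n τ σ hτ))⟩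
  map_zero' := Subtype.ext (funext fun n => funext fun σ => map_zero (sectMap sM c W n σ g hg))
  map_add' s t := Subtype.ext (funext fun n => funext fun σ =>
    map_add (sectMap sM c W n σ g hg) (s.1 n σ) (t.1 n σ))

variable (gr)

theorem chartOpen_mono {W' W : Opens (toricVariety K P ΦM)} (h : W' ≤ W) (σ : fan P ΦM) :
    chartOpen K W' σ ≤ chartOpen K W σ := fun _ hp => h hp

/-- The restriction of sections from `W ∩ U_σ` to `W' ∩ U_σ`. -/
def sectRestrict {W' W : Opens (toricVariety K P ΦM)} (h : W' ≤ W) (n : ℕ) (σ : fan P ΦM) :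
    ChartSections gr sM c W n σ →+ ChartSections gr sM c W' n σ where
  toFun := (structureSheafInType (ChartRing K σ) (Trunc gr sM c n σ)).obj.map
    (homOfLE (chartOpen_mono h σ)).op
  map_zero' := rfl
  map_add' _ _ := rfl

/-- The restriction map from `W` to `W'` of the completion. -/
def completedRestrict {W' W : Opens (toricVariety K P ΦM)} (h : W' ≤ W) :
    completedSections gr sM c W →+ completedSections gr sM c W' where
  toFun s := ⟨fun n σ => sectRestrict gr sM c h n σ (s.1 n σ),
    fun n σ => congrArg (sectRestrict gr sM c h n σ) (s.2.1 n σ),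
    fun n τ σ hτ => congrArg (sectRestrict gr sM c h n τ) (s.2.2 n τ σ hτ)⟩
  map_zero' := rfl
  map_add' _ _ := rfl

end Completion

section Complex

variable (K : Type) [Field K]
variable {ι X Y : Type u} [AddCommGroup X] [AddCommGroup Y]

/-- The element `α(γ)` of `F = k((ε))`, for `γ ∈ 𝔱(F) = X_*(T) ⊗ F`. -/
def rootValue (P : RootDatum ι X Y) {k : Type*} [Field k] (γ : Y ⊗[ℤ] LaurentSeries k) (i : ι) :
    LaurentSeries k :=
  TensorProduct.lid ℤ (LaurentSeries k) ((P.root' i).rTensor (LaurentSeries k) γ)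

/-- The exponent `val(α(γ))`. -/
def rootVal (P : RootDatum ι X Y) {k : Type*} [Field k] (γ : Y ⊗[ℤ] LaurentSeries k) (i : ι) : ℕ :=
  (HahnSeries.order (rootValue P γ i)).toNat

/-- The roots `α` such that `α^∨` is a root of the connected centraliser `Ĝ_s` of `s ∈ T̂`. -/
def centralizerRoots (P : RootDatum ι X Y) (s : Multiplicative Y →* Kˣ) : Set ι :=
  {i | s (Multiplicative.ofAdd (P.coroot i)) = 1}

variable {K} {P : RootDatum ι X Y} {ΦM : Set ι}

/-- `s ∈ T̂` lies above `s_M ∈ Ŝ`. -/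
def LiesOver (s : Multiplicative Y →* Kˣ) (sM : Multiplicative (XS P ΦM) →* Kˣ) : Prop :=
  ∀ l : XS P ΦM, s (Multiplicative.ofAdd (l : Y)) = sM (Multiplicative.ofAdd l)

/-- The set `ℰ̂(s_M)` of the maximal elements among the groups `Ĝ_s`, for `s` above `s_M`. A group
`Ĝ_s` is connected and contains `T̂`; it is given by its roots. -/
def maximalCentralizers (sM : Multiplicative (XS P ΦM) →* Kˣ) : Set (Set ι) :=
  {Ψ | Maximal (fun Ψ' => ∃ s, LiesOver s sM ∧ Ψ' = centralizerRoots K P s) Ψ}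

variable {sM : Multiplicative (XS P ΦM) →* Kˣ} {n : ℕ} (e : Fin n ≃ maximalCentralizers sM)

/-- The roots of `G_I`, whose dual is the identity component of the intersection of the `Ĝ_i`,
for `i ∈ I`; in particular the group attached to the empty set is `G`. -/
def groupRoots (I : Finset (Fin n)) : Set ι := {i | ∀ j ∈ I, i ∈ (e j).1}

variable [Finite ι] [Module.Free ℤ X] (pr : Y →ₗ[ℤ] XS P ΦM) (v : ι → ℕ) (Φp : Set ι)

instance (H : Set ι) : SetLike.GradedSMul (coxGrading K P ΦM) (gradedPiece K pr v Φp H) where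
  smul_mem _ _ _ _ ha hm := smul_mem_gradedPiece K pr ha hm

variable (D : Ray P ΦM → ℤ)

variable (sM) in
/-- The sections over `W` of the completion of the sheaf attached to `L^H(D)`. -/
def FHat (H : Set ι) (W : Opens (toricVariety K P ΦM)) : Type u :=
  completedSections (gradedPiece K pr v Φp H) sM (Submodule.Quotient.mk D) W

instance (H : Set ι) (W : Opens (toricVariety K P ΦM)) :
    AddCommGroup (FHat sM pr v Φp D H W) :=
  inferInstanceAs (AddCommGroup
    (completedSections (gradedPiece K pr v Φp H) sM (Submodule.Quotient.mk D) W))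

variable (sM) in
/-- The map induced by the transfer factor `Δ_{H'}^H` on sections over `W`. -/
def transferHat (H H' : Set ι) (W : Opens (toricVariety K P ΦM)) :
    FHat sM pr v Φp D H W →+ FHat sM pr v Φp D H' W :=
  completedMap sM (Submodule.Quotient.mk D) W (transferLH K pr v Φp H H')
    fun _ _ hm => transferLH_mem K pr hm

/-- The sections over `W` of the term of degree `m` of the complex `𝒦(∅, [n], D)`. -/
def Cochain (W : Opens (toricVariety K P ΦM)) (m : ℕ) : Type u :=
  ∀ I : {I : Finset (Fin n) // I.card = m}, FHat sM pr v Φp D (groupRoots e I.1) W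

instance (W : Opens (toricVariety K P ΦM)) (m : ℕ) : AddCommGroup (Cochain e pr v Φp D W m) :=
  inferInstanceAs (AddCommGroup (∀ I : {I : Finset (Fin n) // I.card = m},
    FHat sM pr v Φp D (groupRoots e I.1) W))

/-- The differential of the complex. The sign is given by `e_i ∧ e_J = ± e_I` for `I = J ∪ {i}`. -/
def differential (W : Opens (toricVariety K P ΦM)) (m : ℕ) :
    Cochain e pr v Φp D W m →+ Cochain e pr v Φp D W (m + 1) where
  toFun c I := ∑ i ∈ I.1.attach, (-1 : ℤ) ^ (I.1.filter (· < i.1)).card •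
    transferHat sM pr v Φp D (groupRoots e (I.1.erase i.1)) (groupRoots e I.1) W
      (c ⟨I.1.erase i.1, by rw [Finset.card_erase_of_mem i.2, I.2, Nat.add_sub_cancel]⟩)
  map_zero' := by
    funext I
    refine Finset.sum_eq_zero fun i _ => ?_
    exact (congrArg _ (map_zero _)).trans (smul_zero _)
  map_add' c c' := by
    funext I
    refine Eq.trans (Finset.sum_congr rfl fun i _ => ?_) Finset.sum_add_distrib
    exact (congrArg _ (map_add _ _ _)).trans (smul_add _ _ _)

/-- The restriction maps of the terms of the complex. -/
def cochainRestrict {W' W : Opens (toricVariety K P ΦM)} (h : W' ≤ W) (m : ℕ)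
    (c : Cochain e pr v Φp D W m) : Cochain e pr v Φp D W' m :=
  fun I => completedRestrict _ sM _ h (c I)

end Complex

end TransferComplex

end

/-!
Write `f_α = y_+^{α^∨} - y_-^{α^∨}`. The complex is the total complex of a cube, with one direction for
each maximal centralizer `Ĝ_i`, and the idea is that near each point of `Y` all the maps of this
cube in one of the directions are isomorphisms; the total complex is then contractible
(`exists_cubeTotal_eq`).

*Transfer factors are invertible up to a function.* Let `E` be the product of the `∂_α ^ {v(α)}` over
the roots in `Φ_+^H - Φ_+^{H'}`, and let `F` be the product of the `f_α ^ {v(α)}` over the same roots.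
The transfer factor `L^H → L^{H'}` is induced by `E`. In the other direction `F` times a section of
`E` induces a well-defined map (`backLT`). Indeed, distinct roots in `Φ_+` are linearly independent, so
integration along a suitable direction shows that `E` is surjective, also on the kernel of each
`∂_β ^ d` for `β ∈ Φ_+^{H'}` (`exists_derProd_eq`), and that the kernel of `E` is the sum of the kernels
of the `∂_α ^ {v(α)}` (`ker_derProd_le`); after multiplication by `F` this kernel lies in
`∑ R_α`. Both composites are the multiplication by `F`.

*The functions `f_α` at a point of the fibre.* On a chart each coroot has constant sign, so that one of
the two monomials of `f_α` is invertible there, and it makes sense to say that `f_α` vanishes at a point.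
Where `f_α` vanishes, the cocharacter `α^∨`, considered as a function, takes the value `1`. The values at
a point of the fibre over `s_M` of the cocharacters in `X_*(S)` and of these coroots lie in `K^×`, and
`K^×` is divisible; so they are the values of some `s ∈ T̂` above `s_M`
(`exists_liesOver_of_fibreIdeal_le`). Hence the roots `α` such that `f_α` vanishes at the point are roots
of one of the `Ĝ_i`, and there the transfer factors in the direction `i` are invertible. Outside of the
fibre all sheaves vanish. The open subsets of `Y` obtained in this way are `goodOpens`.
-/

noncomputable section

namespace TransferComplex

/-! ### Derivations of a symmetric algebra in characteristic zero -/

section Derivations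

variable {K : Type*} [Field K] {S : Type*} [CommRing S] [Algebra K S]

theorem derivation_iterate_eq_zero_of_le {δ : Derivation K S S} {a : S} {m n : ℕ}
    (h : (δ : S →ₗ[K] S) ^ m • a = 0) (hmn : m ≤ n) : (δ : S →ₗ[K] S) ^ n • a = 0 := by
  obtain ⟨c, rfl⟩ := Nat.exists_eq_add_of_le hmn
  rw [add_comm, pow_add, mul_smul, h, smul_zero]

theorem derivation_iterate_mul_eq_zero (δ : Derivation K S S) :
    ∀ (m n : ℕ) (a b : S), (δ : S →ₗ[K] S) ^ m • a = 0 → (δ : S →ₗ[K] S) ^ n • b = 0 →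
      (δ : S →ₗ[K] S) ^ (m + n) • (a * b) = 0 := by
  intro m
  induction m with
  | zero => intro n a b ha _; simp_all
  | succ m ihm =>
    intro n
    induction n with
    | zero => intro a b _ hb; simp_all
    | succ n ihn =>
      intro a b ha hb
      have hδ : (δ : S →ₗ[K] S) • (a * b) = a * δ b + δ a * b := by
        simp [mul_comm]
      have h1 := ihn a (δ b) ha (by rw [pow_succ, mul_smul] at hb; exact hb)
      have h2 := ihm (n + 1) (δ a) b (by rw [pow_succ, mul_smul] at ha; exact ha) hb
      rw [show m + 1 + (n + 1) = (m + 1 + n) + 1 by omega, pow_succ, mul_smul, hδ, smul_add, h1,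
        zero_add, show m + 1 + n = m + (n + 1) by omega, h2]

theorem derivation_iterate_pow_mul {δ : Derivation K S S} {u : S} (hu : δ u = 0) (j : ℕ) (a : S)
    (d : ℕ) : (δ : S →ₗ[K] S) ^ d • (u ^ j * a) = u ^ j * (δ : S →ₗ[K] S) ^ d • a := by
  have h1 (b : S) : δ (u ^ j * b) = u ^ j * δ b := by
    rw [Derivation.leibniz, Derivation.leibniz_pow, hu]; simp
  induction d with
  | zero => simp
  | succ d ih =>
    rw [pow_succ', mul_smul, ih, mul_smul]
    exact h1 _

/-- Integration along `u`: a locally nilpotent derivation `δ` with `δ u = 1` is surjective, and even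
surjective on the kernel of `η ^ d`, for a derivation `η` that commutes with `δ` and kills `u`. -/
theorem exists_derivation_eq [CharZero K] {δ η : Derivation K S S} {u : S} (hu : δ u = 1)
    (hη : η u = 0) (hc : ∀ a, δ (η a) = η (δ a)) (d : ℕ) :
    ∀ (N j : ℕ) (a : S), (δ : S →ₗ[K] S) ^ N • a = 0 → (η : S →ₗ[K] S) ^ d • a = 0 →
      ∃ b, δ b = u ^ j * a ∧ (η : S →ₗ[K] S) ^ d • b = 0 := by
  intro N
  induction N with
  | zero => intro j a ha _; exact ⟨0, by simp_all⟩
  | succ N ih =>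
    intro j a ha hd
    have hcomm : Commute (δ : S →ₗ[K] S) (η : S →ₗ[K] S) := LinearMap.ext hc
    obtain ⟨b, hb, hbd⟩ := ih (j + 1) (δ a) (by rw [pow_succ, mul_smul] at ha; exact ha) (by
      have h := (hcomm.pow_right d).eq
      have h2 : ((η : S →ₗ[K] S) ^ d * (δ : S →ₗ[K] S)) • a =
          ((δ : S →ₗ[K] S) * (η : S →ₗ[K] S) ^ d) • a := by rw [h]
      rw [mul_smul, mul_smul, hd, smul_zero] at h2
      exact h2)
    have hj : ((j + 1 : ℕ) : K) ≠ 0 := Nat.cast_ne_zero.2 (Nat.succ_ne_zero j)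
    -- integration by parts
    refine ⟨((j + 1 : ℕ) : K)⁻¹ • (u ^ (j + 1) * a - b), ?_, ?_⟩
    · rw [Derivation.map_smul, map_sub, hb, Derivation.leibniz, Derivation.leibniz_pow, hu,
        smul_eq_mul, smul_eq_mul, add_sub_cancel_left, inv_smul_eq_iff₀ hj, Nat.add_sub_cancel,
        smul_eq_mul, mul_one, nsmul_eq_mul, Nat.cast_smul_eq_nsmul, nsmul_eq_mul]
      ring
    · rw [smul_comm, smul_sub, hbd, derivation_iterate_pow_mul hη, hd]
      simp

end Derivations

section Sym

variable {K : Type} [Field K] {V : Type u} [AddCommGroup V] [Module K V]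

theorem symDer_locally_nilpotent (f : V →ₗ[K] K) (s : SymmetricAlgebra K V) :
    ∃ N : ℕ, (symDer f : SymmetricAlgebra K V →ₗ[K] SymmetricAlgebra K V) ^ N • s = 0 := by
  induction s using SymmetricAlgebra.induction with
  | algebraMap r => exact ⟨1, by simp⟩
  | ι x => exact ⟨2, by simp [pow_two, mul_smul, symDer_ι]⟩
  | mul a b ha hb =>
    obtain ⟨m, hm⟩ := ha
    obtain ⟨n, hn⟩ := hb
    exact ⟨m + n, derivation_iterate_mul_eq_zero _ _ _ _ _ hm hn⟩
  | add a b ha hb =>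
    obtain ⟨m, hm⟩ := ha
    obtain ⟨n, hn⟩ := hb
    exact ⟨m + n, by
      rw [smul_add, derivation_iterate_eq_zero_of_le hm (Nat.le_add_right _ _),
        derivation_iterate_eq_zero_of_le hn (Nat.le_add_left _ _), add_zero]⟩

theorem exists_symDer_pow_eq [CharZero K] {f g : V →ₗ[K] K} {x : V} (hf : f x = 1) (hg : g x = 0)
    (d v : ℕ) (s : SymmetricAlgebra K V)
    (hs : (symDer g : SymmetricAlgebra K V →ₗ[K] SymmetricAlgebra K V) ^ d • s = 0) :
    ∃ s', (symDer f : SymmetricAlgebra K V →ₗ[K] SymmetricAlgebra K V) ^ v • s' = s ∧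
      (symDer g : SymmetricAlgebra K V →ₗ[K] SymmetricAlgebra K V) ^ d • s' = 0 := by
  induction v generalizing s with
  | zero => exact ⟨s, by simp, hs⟩
  | succ v ih =>
    obtain ⟨t, ht, htd⟩ := ih s hs
    obtain ⟨N, hN⟩ := symDer_locally_nilpotent f t
    obtain ⟨b, hb, hbd⟩ := exists_derivation_eq (δ := symDer f) (η := symDer g)
      (u := SymmetricAlgebra.ι K V x) (by rw [symDer_ι, hf, map_one]) (by rw [symDer_ι, hg, map_zero])
      (symDer_comm f g) d N 0 t hN htd
    refine ⟨b, ?_, hbd⟩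
    rw [pow_succ, mul_smul]
    rw [pow_zero, one_mul] at hb
    exact (congrArg _ hb).trans ht

end Sym

/-! ### Products of derivations attached to pairwise independent roots -/

section Roots

variable (K : Type) [Field K]
variable {ι X Y : Type u} [AddCommGroup X] [AddCommGroup Y] (P : RootDatum ι X Y)

/-- The linear form on `X_*(T) ⊗ K` defined by a character `χ`. -/
def charForm (χ : X) : K ⊗[ℤ] Y →ₗ[K] K :=
  (TensorProduct.AlgebraTensorModule.rid ℤ K K).toLinearMap ∘ₗ (P.toLinearMap χ).baseChange K

theorem charForm_tmul (χ : X) (a : K) (y : Y) :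
    charForm K P χ (a ⊗ₜ y) = (P.toLinearMap χ y : K) * a := by
  simp [charForm]

variable {P} in
theorem root_ne_of_mem_halfSystem {Φp : Set ι} (hΦp : IsHalfSystem P Φp) {i j : ι} (hi : i ∈ Φp)
    (hj : j ∈ Φp) : P.root i ≠ -P.root j := by
  intro h
  have hn : i = neg P j := P.root.injective (by
    rw [h]; simp [neg, RootPairing.root_reflectionPerm])
  rcases hΦp j with h | h
  · exact h.2 (hn ▸ hi)
  · exact h.1 hj

/-- Two distinct roots of a half-system are linearly independent, also over `K`. -/
theorem exists_charForm_eq_one_eq_zero [CharZero K] [P.IsReduced] {Φp : Set ι}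
    (hΦp : IsHalfSystem P Φp) {i j : ι} (hi : i ∈ Φp) (hj : j ∈ Φp) (hij : i ≠ j) :
    ∃ x, charForm K P (P.root i) x = 1 ∧ charForm K P (P.root j) x = 0 := by
  have hli : LinearIndependent ℤ ![P.root i, P.root j] := by
    by_contra h
    rcases RootPairing.IsReduced.eq_or_eq_neg (P := P) i j h with h | h
    · exact hij (P.root.injective h)
    · exact root_ne_of_mem_halfSystem hΦp hi hj h
  -- a cocharacter killed by `j` but not by `i`: otherwise `2 • i = ⟨i, j^∨⟩ • j`
  obtain ⟨y, hy⟩ : ∃ y : Y, P.toLinearMap (P.root i)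
      ((2 : ℤ) • y - P.toLinearMap (P.root j) y • P.coroot j) ≠ 0 := by
    by_contra! h
    have h0 : (2 : ℤ) • P.root i + (-(P.pairing i j)) • P.root j = 0 := by
      apply P.toPerfPair.injective
      ext y
      have h1 := h y
      simp only [map_sub, map_smul, smul_eq_mul, RootPairing.root_coroot_eq_pairing] at h1
      simp only [map_add, map_smul, LinearMap.add_apply, LinearMap.smul_apply, smul_eq_mul, map_zero,
        LinearMap.zero_apply, LinearMap.toPerfPair_apply]
      linarith
    exact two_ne_zero (LinearIndependent.pair_iff.1 hli _ _ h0).1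
  set w := (2 : ℤ) • y - P.toLinearMap (P.root j) y • P.coroot j with hw
  have hjw : P.toLinearMap (P.root j) w = 0 := by
    simp only [hw, map_sub, map_smul, smul_eq_mul, RootPairing.root_coroot_eq_pairing,
      RootPairing.pairing_same]
    ring
  refine ⟨((P.toLinearMap (P.root i) w : ℤ) : K)⁻¹ ⊗ₜ w, ?_, ?_⟩
  · rw [charForm_tmul, mul_inv_cancel₀ (Int.cast_ne_zero.2 hy)]
  · rw [charForm_tmul, hjw, Int.cast_zero, zero_mul]

theorem exists_charForm_eq_one [CharZero K] (i : ι) : ∃ x, charForm K P (P.root i) x = 1 := by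
  refine ⟨(2 : K)⁻¹ ⊗ₜ P.coroot i, ?_⟩
  rw [charForm_tmul]
  simp

theorem symDer_zero {V : Type u} [AddCommGroup V] [Module K V] (s : SymmetricAlgebra K V) :
    symDer (0 : V →ₗ[K] K) s = 0 := by
  induction s using SymmetricAlgebra.induction with
  | algebraMap r => simp
  | ι x => simp [symDer_ι]
  | mul a b ha hb => rw [Derivation.leibniz, ha, hb]; simp
  | add a b ha hb => rw [map_add, ha, hb, add_zero]

theorem derEnd_pow_surjective [CharZero K] (i : ι) (v : ℕ) :
    Function.Surjective (derEnd K P (P.root i) ^ v) := by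
  intro s
  obtain ⟨x, hx⟩ := exists_charForm_eq_one K P i
  obtain ⟨s', hs', -⟩ := exists_symDer_pow_eq hx (LinearMap.zero_apply x) 1 v s (by
    rw [pow_one]; exact symDer_zero K s)
  exact ⟨s', hs'⟩

theorem exists_derEnd_pow_eq [CharZero K] [P.IsReduced] {Φp : Set ι}
    (hΦp : IsHalfSystem P Φp) {i j : ι} (hi : i ∈ Φp) (hj : j ∈ Φp) (hij : i ≠ j) (d v : ℕ)
    (s : SymT K Y) (hs : (derEnd K P (P.root j) ^ d) s = 0) :
    ∃ s', (derEnd K P (P.root i) ^ v) s' = s ∧ (derEnd K P (P.root j) ^ d) s' = 0 := by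
  obtain ⟨x, hx, hx'⟩ := exists_charForm_eq_one_eq_zero K P hΦp hi hj hij
  exact exists_symDer_pow_eq hx hx' d v s hs

/-- The operator `∏_{α ∈ S} ∂_α ^ {v(α)}`. -/
def derProd (v : ι → ℕ) (S : Finset ι) : Module.End K (SymT K Y) :=
  S.noncommProd (fun i => derEnd K P (P.root i) ^ v i)
    (fun i _ j _ _ => derEnd_pow_commute K P v i j)

theorem derProd_empty (v : ι → ℕ) : derProd K P v ∅ = 1 := Finset.noncommProd_empty _ _

theorem derProd_insert [DecidableEq ι] (v : ι → ℕ) {S : Finset ι} {i : ι} (hi : i ∉ S) :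
    derProd K P v (insert i S) = derProd K P v S * derEnd K P (P.root i) ^ v i :=
  Finset.noncommProd_insert_of_notMem' _ _ _ _ hi

theorem derProd_surjective [CharZero K] (v : ι → ℕ) (S : Finset ι) :
    Function.Surjective (derProd K P v S) := by
  classical
  induction S using Finset.induction_on with
  | empty => rw [derProd_empty]; exact Function.surjective_id
  | insert i S hi ih =>
    rw [derProd_insert K P v hi]
    exact ih.comp (derEnd_pow_surjective K P i (v i))

/-- The product of the `∂_α ^ {v(α)}` maps the kernel of `∂_β ^ d` onto itself, for `β` not among the
`α`. -/
theorem exists_derProd_eq [CharZero K] [P.IsReduced] {Φp : Set ι}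
    (hΦp : IsHalfSystem P Φp) (v : ι → ℕ) (S : Finset ι) (hS : ∀ i ∈ S, i ∈ Φp) {j : ι}
    (hj : j ∈ Φp) (hjS : j ∉ S) (d : ℕ) (s : SymT K Y) (hs : (derEnd K P (P.root j) ^ d) s = 0) :
    ∃ s', derProd K P v S s' = s ∧ (derEnd K P (P.root j) ^ d) s' = 0 := by
  classical
  induction S using Finset.induction_on generalizing s with
  | empty => exact ⟨s, by rw [derProd_empty]; rfl, hs⟩
  | insert i S hi ih =>
    obtain ⟨t, ht, htd⟩ := ih (fun i h => hS i (Finset.mem_insert_of_mem h))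
      (fun h => hjS (Finset.mem_insert_of_mem h)) s hs
    obtain ⟨s', hs', hd⟩ := exists_derEnd_pow_eq K P hΦp (hS i (Finset.mem_insert_self _ _)) hj
      (fun h => hjS (h ▸ Finset.mem_insert_self _ _)) d (v i) t htd
    refine ⟨s', ?_, hd⟩
    rw [derProd_insert K P v hi, Module.End.mul_apply, hs', ht]

/-- The kernel of a product of powers of pairwise independent derivations `∂_α` is the sum of the
kernels of the factors. -/
theorem ker_derProd_le [CharZero K] [P.IsReduced] {Φp : Set ι}
    (hΦp : IsHalfSystem P Φp) (v : ι → ℕ) (S : Finset ι) (hS : ∀ i ∈ S, i ∈ Φp) :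
    LinearMap.ker (derProd K P v S) ≤
      ⨆ i ∈ S, LinearMap.ker (derEnd K P (P.root i) ^ v i) := by
  classical
  induction S using Finset.induction_on with
  | empty =>
    intro s hs
    rw [LinearMap.mem_ker, derProd_empty] at hs
    rw [show s = 0 from hs]
    exact zero_mem _
  | insert i S hi ih =>
    have ih := ih fun i h => hS i (Finset.mem_insert_of_mem h)
    have hiΦ := hS i (Finset.mem_insert_self _ _)
    -- `∂_i ^ v` maps the sum of the kernels of the other factors onto itself
    have key : (⨆ j ∈ S, LinearMap.ker (derEnd K P (P.root j) ^ v j)) ≤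
        (⨆ j ∈ insert i S, LinearMap.ker (derEnd K P (P.root j) ^ v j)).map
          (derEnd K P (P.root i) ^ v i) := by
      refine iSup₂_le fun j hj t ht => ?_
      obtain ⟨s', hs', hd⟩ := exists_derEnd_pow_eq K P hΦp hiΦ
        (hS j (Finset.mem_insert_of_mem hj)) (fun h => hi (h ▸ hj)) (v j) (v i) t ht
      exact ⟨s', Submodule.mem_iSup_of_mem j
        (Submodule.mem_iSup_of_mem (Finset.mem_insert_of_mem hj) hd), hs'⟩
    intro s hs
    rw [LinearMap.mem_ker, derProd_insert K P v hi, Module.End.mul_apply] at hs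
    obtain ⟨s', hs', hd⟩ := key (ih hs)
    have h0 : s - s' ∈ LinearMap.ker (derEnd K P (P.root i) ^ v i) := by
      rw [LinearMap.mem_ker, map_sub, hd, sub_self]
    rw [← sub_add_cancel s s']
    exact add_mem (Submodule.mem_iSup_of_mem i
      (Submodule.mem_iSup_of_mem (Finset.mem_insert_self _ _) h0)) hs'

end Roots

/-! ### Transfer factors up to a function on the toric variety -/

section BackTransfer

variable (K : Type) [Field K]
variable {ι X Y : Type u} [AddCommGroup X] [AddCommGroup Y] {P : RootDatum ι X Y}
variable [Finite ι] [Module.Free ℤ X] {ΦM : Set ι} (pr : Y →ₗ[ℤ] XS P ΦM)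

/-- The element `y_+^{α^∨} - y_-^{α^∨}` of `A`. -/
def rootElt (i : ι) : Cox K P ΦM := yPlus K pr (P.coroot i) - yMinus K P ΦM (P.coroot i)

/-- The set `Φ_+^H - Φ_+^{H'}`. -/
def rootDiff (Φp H H' : Set ι) : Finset ι := (Set.toFinite ((Φp ∩ H) \ (Φp ∩ H'))).toFinset

theorem mem_rootDiff {Φp H H' : Set ι} {i : ι} :
    i ∈ rootDiff Φp H H' ↔ i ∈ Φp ∧ i ∈ H ∧ i ∉ H' := by
  simp only [rootDiff, Set.Finite.mem_toFinset, Set.mem_sdiff, Set.mem_inter_iff]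
  tauto

omit [Module.Free ℤ X] in
theorem transfer_eq_derProd (v : ι → ℕ) (Φp H H' : Set ι) :
    transfer K P v Φp H H' = derProd K P v (rootDiff Φp H H') := rfl

/-- The element `∏ (y_+^{α^∨} - y_-^{α^∨}) ^ {v(α)}` of `A`, the product being over the roots in
`Φ_+^H - Φ_+^{H'}`. -/
def diffElt (v : ι → ℕ) (Φp H H' : Set ι) : Cox K P ΦM :=
  ∏ i ∈ rootDiff Φp H H', rootElt K pr i ^ v i

variable (v : ι → ℕ) {Φp : Set ι}

theorem tmul_mem_relations {H : Set ι} {i : ι} (hi : i ∈ Φp ∩ H) (a : Cox K P ΦM) {s : SymT K Y}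
    {d : ℕ} (hd : d ∈ Finset.Icc 1 (v i)) (hs : (derEnd K P (P.root i) ^ d) s = 0) :
    (rootElt K pr i ^ d * a) ⊗ₜ[K] s ∈ relations K pr v Φp H := by
  refine Submodule.mem_iSup_of_mem i (Submodule.mem_iSup_of_mem hi (Submodule.mem_iSup_of_mem d
    (Submodule.mem_iSup_of_mem hd ?_)))
  rw [mul_comm, ← smul_eq_mul, ← TensorProduct.smul_tmul']
  exact Submodule.smul_mem _ _ (Submodule.subset_span ⟨s, hs, rfl⟩)

variable [CharZero K] [P.IsReduced]

/-- Multiplication by `diffElt` sends the kernel of the transfer factor into the relations. -/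
theorem diffElt_mul_tmul_mem_relations (hΦp : IsHalfSystem P Φp) (H H' : Set ι) (a : Cox K P ΦM)
    {s : SymT K Y} (hs : transfer K P v Φp H H' s = 0) :
    (diffElt K pr v Φp H H' * a) ⊗ₜ[K] s ∈ relations K pr v Φp H := by
  classical
  have h1 := ker_derProd_le K P hΦp v (rootDiff Φp H H')
    (fun i hi => (mem_rootDiff.1 hi).1) (LinearMap.mem_ker.2 hs)
  suffices h : (⨆ i ∈ rootDiff Φp H H', LinearMap.ker (derEnd K P (P.root i) ^ v i)) ≤
      ((relations K pr v Φp H).restrictScalars K).comap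
        (TensorProduct.mk K (Cox K P ΦM) (SymT K Y) (diffElt K pr v Φp H H' * a)) from h h1
  refine iSup₂_le fun i hi t ht => ?_
  change _ ⊗ₜ[K] t ∈ relations K pr v Φp H
  rw [LinearMap.mem_ker] at ht
  obtain hv | hv := Nat.eq_zero_or_pos (v i)
  · rw [hv, pow_zero] at ht
    rw [show t = 0 from ht, TensorProduct.tmul_zero]
    exact zero_mem _
  · rw [diffElt, ← Finset.mul_prod_erase _ _ hi, mul_assoc]
    have hi' := mem_rootDiff.1 hi
    exact tmul_mem_relations K pr v ⟨hi'.1, hi'.2.1⟩ _ (Finset.mem_Icc.2 ⟨hv, le_rfl⟩) ht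

theorem diffElt_smul_baseChange_mem_relations (hΦp : IsHalfSystem P Φp) (H H' : Set ι)
    {J : Module.End K (SymT K Y)} (hJ : transfer K P v Φp H H' * J = 0)
    (t : Cox K P ΦM ⊗[K] SymT K Y) :
    diffElt K pr v Φp H H' • J.baseChange (Cox K P ΦM) t ∈ relations K pr v Φp H := by
  induction t using TensorProduct.induction_on with
  | zero => rw [map_zero, smul_zero]; exact zero_mem _
  | add x y hx hy => rw [map_add, smul_add]; exact add_mem hx hy
  | tmul a s =>
    rw [LinearMap.baseChange_tmul, TensorProduct.smul_tmul', smul_eq_mul]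
    exact diffElt_mul_tmul_mem_relations K pr v hΦp H H' a (LinearMap.congr_fun hJ s)

/-- A linear section of the transfer factor `Δ_{H'}^H` acting on `𝒮`. -/
def transferSection (P : RootDatum ι X Y) (Φp H H' : Set ι) : Module.End K (SymT K Y) :=
  ((transfer K P v Φp H H').exists_rightInverse_of_surjective
    (LinearMap.range_eq_top.2 (derProd_surjective K P v _))).choose

omit [Module.Free ℤ X] [P.IsReduced] in
theorem transfer_mul_transferSection (H H' : Set ι) :
    transfer K P v Φp H H' * transferSection K v P Φp H H' = 1 :=
  ((transfer K P v Φp H H').exists_rightInverse_of_surjective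
    (LinearMap.range_eq_top.2 (derProd_surjective K P v _))).choose_spec

theorem relations_le_ker_back (hΦp : IsHalfSystem P Φp) {H H' : Set ι} (hH : H' ⊆ H) :
    relations K pr v Φp H' ≤ LinearMap.ker ((relations K pr v Φp H).mkQ ∘ₗ
      (diffElt K pr v Φp H H' • (transferSection K v P Φp H H').baseChange (Cox K P ΦM))) := by
  refine iSup₂_le fun j hj => iSup₂_le fun d hd => Submodule.span_le.2 ?_
  rintro _ ⟨s, hs, rfl⟩
  obtain ⟨s', hs', hd'⟩ := exists_derProd_eq K P hΦp v (rootDiff Φp H H')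
    (fun i hi => (mem_rootDiff.1 hi).1) hj.1 (fun h => (mem_rootDiff.1 h).2.2 hj.2) d s hs
  have h0 : transfer K P v Φp H H' (transferSection K v P Φp H H' s - s') = 0 := by
    rw [map_sub, transfer_eq_derProd K v, hs', ← transfer_eq_derProd, sub_eq_zero]
    exact LinearMap.congr_fun (transfer_mul_transferSection K v H H') s
  rw [SetLike.mem_coe, LinearMap.mem_ker, LinearMap.comp_apply, Submodule.mkQ_apply,
    Submodule.Quotient.mk_eq_zero, LinearMap.smul_apply, LinearMap.baseChange_tmul,
    TensorProduct.smul_tmul', smul_eq_mul,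
    ← sub_add_cancel (transferSection K v P Φp H H' s) s', TensorProduct.tmul_add]
  refine add_mem (diffElt_mul_tmul_mem_relations K pr v hΦp H H' _ h0) ?_
  rw [mul_comm]
  exact tmul_mem_relations K pr v ⟨hj.1, hH hj.2⟩ _ hd hd'

/-- An inverse of `Δ_{H'}^H : L_T^H → L_T^{H'}` up to the element `diffElt` of `A`: it is this element
times a section of `Δ_{H'}^H`, which does not depend on the section. -/
def backLT (hΦp : IsHalfSystem P Φp) {H H' : Set ι} (hH : H' ⊆ H) :
    LT K pr v Φp H' →ₗ[Cox K P ΦM] LT K pr v Φp H :=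
  (relations K pr v Φp H').liftQ _ (relations_le_ker_back K pr v hΦp hH)

theorem backLT_mk (hΦp : IsHalfSystem P Φp) {H H' : Set ι} (hH : H' ⊆ H)
    (t : Cox K P ΦM ⊗[K] SymT K Y) :
    backLT K pr v hΦp hH (Submodule.Quotient.mk t) = Submodule.Quotient.mk
      (diffElt K pr v Φp H H' • (transferSection K v P Φp H H').baseChange (Cox K P ΦM) t) := rfl

theorem transferLT_backLT (hΦp : IsHalfSystem P Φp) {H H' : Set ι} (hH : H' ⊆ H)
    (x : LT K pr v Φp H') :
    transferLT K pr v Φp H H' (backLT K pr v hΦp hH x) = diffElt K pr v Φp H H' • x := by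
  obtain ⟨t, rfl⟩ := Submodule.Quotient.mk_surjective _ x
  rw [backLT_mk, Submodule.Quotient.mk_smul, map_smul]
  refine congrArg _ (congrArg Submodule.Quotient.mk ?_)
  rw [← LinearMap.comp_apply, ← LinearMap.baseChange_comp,
    show _ ∘ₗ _ = _ from transfer_mul_transferSection K v H H']
  exact LinearMap.congr_fun (LinearMap.baseChange_id ..) t

theorem backLT_transferLT (hΦp : IsHalfSystem P Φp) {H H' : Set ι} (hH : H' ⊆ H)
    (x : LT K pr v Φp H) :
    backLT K pr v hΦp hH (transferLT K pr v Φp H H' x) = diffElt K pr v Φp H H' • x := by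
  obtain ⟨t, rfl⟩ := Submodule.Quotient.mk_surjective _ x
  have h := diffElt_smul_baseChange_mem_relations K pr v hΦp H H'
    (J := transferSection K v P Φp H H' * transfer K P v Φp H H' - 1)
    (by rw [mul_sub, ← mul_assoc, transfer_mul_transferSection, one_mul, mul_one, sub_self]) t
  rw [LinearMap.baseChange_sub, LinearMap.sub_apply, smul_sub] at h
  refine ((Submodule.Quotient.eq _).2 ?_)
  convert h using 3
  · rw [LinearMap.smul_apply, ← LinearMap.comp_apply, ← LinearMap.baseChange_comp]
    rfl
  · exact (LinearMap.congr_fun (LinearMap.baseChange_id ..) t).symm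

theorem derLT_backLT (hΦp : IsHalfSystem P Φp) {H H' : Set ι} (hH : H' ⊆ H) (χ : X)
    (x : LT K pr v Φp H') :
    derLT K pr v Φp H χ (backLT K pr v hΦp hH x) =
      backLT K pr v hΦp hH (derLT K pr v Φp H' χ x) := by
  obtain ⟨t, rfl⟩ := Submodule.Quotient.mk_surjective _ x
  have hc := (derEnd_commute_transfer K P v Φp H H' χ).eq
  have h := diffElt_smul_baseChange_mem_relations K pr v hΦp H H'
    (J := derEnd K P χ * transferSection K v P Φp H H' -
      transferSection K v P Φp H H' * derEnd K P χ)
    (by rw [mul_sub, ← mul_assoc, ← hc, ← mul_assoc, mul_assoc, transfer_mul_transferSection,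
      one_mul, mul_one, sub_self]) t
  rw [LinearMap.baseChange_sub, LinearMap.sub_apply, smul_sub] at h
  refine ((Submodule.Quotient.eq _).2 ?_)
  convert h using 2
  · rw [LinearMap.smul_apply, map_smul, ← LinearMap.comp_apply, ← LinearMap.baseChange_comp]
    rfl
  · rw [LinearMap.smul_apply, ← LinearMap.comp_apply, ← LinearMap.baseChange_comp]
    rfl

/-- The restriction of `backLT` to the elements killed by the derivations. -/
def backLH (hΦp : IsHalfSystem P Φp) {H H' : Set ι} (hH : H' ⊆ H) :
    LH K pr v Φp H' →ₗ[Cox K P ΦM] LH K pr v Φp H :=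
  (backLT K pr v hΦp hH).restrict fun x hx => by
    refine (Submodule.mem_iInf _).2 fun χ => ?_
    rw [LinearMap.mem_ker, derLT_backLT,
      LinearMap.mem_ker.1 ((Submodule.mem_iInf _).1 hx χ), map_zero]

theorem transferLH_backLH (hΦp : IsHalfSystem P Φp) {H H' : Set ι} (hH : H' ⊆ H)
    (x : LH K pr v Φp H') :
    transferLH K pr v Φp H H' (backLH K pr v hΦp hH x) = diffElt K pr v Φp H H' • x :=
  Subtype.ext (transferLT_backLT K pr v hΦp hH x.1)

theorem backLH_transferLH (hΦp : IsHalfSystem P Φp) {H H' : Set ι} (hH : H' ⊆ H)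
    (x : LH K pr v Φp H) :
    backLH K pr v hΦp hH (transferLH K pr v Φp H H' x) = diffElt K pr v Φp H H' • x :=
  Subtype.ext (backLT_transferLT K pr v hΦp hH x.1)

theorem backLH_mem (hΦp : IsHalfSystem P Φp) {H H' : Set ι} (hH : H' ⊆ H) {d e : ClassGp P ΦM}
    (hd : diffElt K pr v Φp H H' ∈ coxGrading K P ΦM d) {m : LH K pr v Φp H'}
    (hm : m ∈ gradedPiece K pr v Φp H' e) :
    backLH K pr v hΦp hH m ∈ gradedPiece K pr v Φp H (d + e) := by
  obtain ⟨t, ht, hm⟩ := hm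
  refine ⟨diffElt K pr v Φp H H' • (transferSection K v P Φp H H').baseChange (Cox K P ΦM) t,
    ?_, ?_⟩
  · clear hm
    induction ht using AddSubgroup.closure_induction with
    | mem t h =>
      obtain ⟨b, hb, s, rfl⟩ := h
      refine AddSubgroup.subset_closure ⟨diffElt K pr v Φp H H' * b,
        SetLike.mul_mem_graded hd hb, transferSection K v P Φp H H' s, ?_⟩
      rw [LinearMap.baseChange_tmul, TensorProduct.smul_tmul', smul_eq_mul]
    | zero => rw [map_zero, smul_zero]; exact zero_mem _
    | add x y _ _ hx hy => rw [map_add, smul_add]; exact add_mem hx hy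
    | neg x _ hx => rw [map_neg, smul_neg]; exact neg_mem hx
  · change backLT K pr v hΦp hH ((relations K pr v Φp H').mkQ t) =
      backLT K pr v hΦp hH (m : LT K pr v Φp H')
    exact congrArg _ hm

end BackTransfer

/-! ### Homogeneous functions on the charts -/

section Nonvanishing

variable (K : Type) [Field K]
variable {ι X Y : Type u} [AddCommGroup X] [AddCommGroup Y] {P : RootDatum ι X Y} {ΦM : Set ι}

theorem mk_eq_mk_mul_mk {σ : fan P ΦM} {d : ClassGp P ΦM} (F u u' : coxGrading K P ΦM d)
    (hu : (u : Cox K P ΦM) ∈ denoms K σ) (hu' : (u' : Cox K P ΦM) ∈ denoms K σ) :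
    (HomogeneousLocalization.mk ⟨d, F, u', hu'⟩ : ChartRing K σ) =
      HomogeneousLocalization.mk ⟨d, F, u, hu⟩ * HomogeneousLocalization.mk ⟨d, u, u', hu'⟩ := by
  apply HomogeneousLocalization.val_injective
  rw [HomogeneousLocalization.val_mul, HomogeneousLocalization.val_mk, HomogeneousLocalization.val_mk,
    HomogeneousLocalization.val_mk, Localization.mk_mul, Localization.mk_eq_mk_iff,
    Localization.r_iff_exists]
  exact ⟨1, by simp only [Submonoid.coe_mul]; ring⟩

/-- The points of the chart `U_σ` at which a homogeneous element `F` of `A` does not vanish, that is,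
at which the function `F / u` does not vanish, for a denominator `u` of the same degree. -/
def nonvanishing (σ : fan P ΦM) {d : ClassGp P ΦM} (F : coxGrading K P ΦM d) :
    Set (PrimeSpectrum (ChartRing K σ)) :=
  {p | ∃ u : coxGrading K P ΦM d, ∃ hu : (u : Cox K P ΦM) ∈ denoms K σ,
    (HomogeneousLocalization.mk ⟨d, F, u, hu⟩ : ChartRing K σ) ∉ p.asIdeal}

theorem isOpen_nonvanishing (σ : fan P ΦM) {d : ClassGp P ΦM} (F : coxGrading K P ΦM d) :
    IsOpen (nonvanishing K σ F) := by
  have h : nonvanishing K σ F = ⋃ u : {u : coxGrading K P ΦM d // (u : Cox K P ΦM) ∈ denoms K σ},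
      (PrimeSpectrum.basicOpen
        (HomogeneousLocalization.mk ⟨d, F, u.1, u.2⟩ : ChartRing K σ) : Set _) := by
    ext p
    simp [nonvanishing]
  rw [h]
  exact isOpen_iUnion fun u => (PrimeSpectrum.basicOpen _).2

variable {K}

theorem mk_notMem_of_mem_nonvanishing {σ : fan P ΦM} {d : ClassGp P ΦM}
    {F : coxGrading K P ΦM d} {p : PrimeSpectrum (ChartRing K σ)} (hp : p ∈ nonvanishing K σ F)
    (u : coxGrading K P ΦM d) (hu : (u : Cox K P ΦM) ∈ denoms K σ) :
    (HomogeneousLocalization.mk ⟨d, F, u, hu⟩ : ChartRing K σ) ∉ p.asIdeal := by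
  obtain ⟨u', hu', h⟩ := hp
  intro hm
  rw [mk_eq_mk_mul_mk K F u u' hu hu'] at h
  exact h (Ideal.mul_mem_right _ _ hm)

theorem mem_nonvanishing_iff_comap {τ σ : fan P ΦM} (h : τ ≤ σ) {d : ClassGp P ΦM}
    {F : coxGrading K P ΦM d} (hF : ∃ u ∈ coxGrading K P ΦM d, u ∈ denoms K σ)
    (p : PrimeSpectrum (ChartRing K τ)) :
    PrimeSpectrum.comap (chartRes K h) p ∈ nonvanishing K σ F ↔ p ∈ nonvanishing K τ F := by
  constructor
  · rintro ⟨u, hu, hp⟩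
    exact ⟨u, denoms_mono K h hu, hp⟩
  · intro hp
    obtain ⟨u, hu, hu'⟩ := hF
    exact ⟨⟨u, hu⟩, hu', mk_notMem_of_mem_nonvanishing hp ⟨u, hu⟩ (denoms_mono K h hu')⟩

theorem exists_prod_mk_notMem {σ : fan P ΦM} (p : PrimeSpectrum (ChartRing K σ))
    (F : ι → Cox K P ΦM) (v : ι → ℕ) (S : Finset ι)
    (hF : ∀ i ∈ S, ∃ d, ∃ hd : F i ∈ coxGrading K P ΦM d,
      p ∈ nonvanishing K σ (⟨F i, hd⟩ : coxGrading K P ΦM d)) :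
    ∃ d, ∃ hd : ∏ i ∈ S, F i ^ v i ∈ coxGrading K P ΦM d,
      p ∈ nonvanishing K σ (⟨_, hd⟩ : coxGrading K P ΦM d) := by
  classical
  have hmul : ∀ a b : Cox K P ΦM, (∃ d, ∃ hd : a ∈ coxGrading K P ΦM d,
      p ∈ nonvanishing K σ (⟨a, hd⟩ : coxGrading K P ΦM d)) → (∃ d, ∃ hd : b ∈ coxGrading K P ΦM d,
      p ∈ nonvanishing K σ (⟨b, hd⟩ : coxGrading K P ΦM d)) →
      ∃ d, ∃ hd : a * b ∈ coxGrading K P ΦM d,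
      p ∈ nonvanishing K σ (⟨a * b, hd⟩ : coxGrading K P ΦM d) := by
    rintro a b ⟨d, hd, u, hu, ha⟩ ⟨d', hd', u', hu', hb⟩
    refine ⟨d + d', SetLike.mul_mem_graded hd hd', ⟨u * u', SetLike.mul_mem_graded u.2 u'.2⟩,
      mul_mem hu hu', fun h => ?_⟩
    exact (p.2.mem_or_mem (show HomogeneousLocalization.mk ⟨d, ⟨a, hd⟩, u, hu⟩ *
      HomogeneousLocalization.mk ⟨d', ⟨b, hd'⟩, u', hu'⟩ ∈ p.asIdeal from h)).elim ha hb
  have hone : ∃ d, ∃ hd : (1 : Cox K P ΦM) ∈ coxGrading K P ΦM d,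
      p ∈ nonvanishing K σ (⟨1, hd⟩ : coxGrading K P ΦM d) :=
    ⟨0, SetLike.GradedOne.one_mem, ⟨1, SetLike.GradedOne.one_mem⟩, one_mem _,
      (Ideal.ne_top_iff_one _).1 p.2.ne_top⟩
  induction S using Finset.induction_on with
  | empty => simpa using hone
  | insert i S hi ih =>
    rw [Finset.prod_insert hi]
    refine hmul _ _ ?_ (ih fun i h => hF i (Finset.mem_insert_of_mem h))
    induction v i with
    | zero => simpa using hone
    | succ m ihm =>
      rw [pow_succ]
      exact hmul _ _ ihm (hF i (Finset.mem_insert_self _ _))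

end Nonvanishing

section Monomials

variable (K : Type) [Field K]
variable {ι X Y : Type u} [AddCommGroup X] [AddCommGroup Y] {P : RootDatum ι X Y} {ΦM : Set ι}

theorem monomial_mem_denoms {σ : fan P ΦM} {m : Ray P ΦM →₀ ℕ}
    (hm : ∀ ρ : Ray P ΦM, (1 : ℝ) ⊗ₜ[ℤ] ρ.1 ∈ σ.1 → m ρ = 0) :
    (MvPolynomial.monomial m 1 : Cox K P ΦM) ∈ denoms K σ := by
  rw [MvPolynomial.monomial_eq, map_one, one_mul]
  refine prod_mem fun ρ _ => ?_
  change MvPolynomial.X ρ ^ m ρ ∈ denoms K σ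
  by_cases h : (1 : ℝ) ⊗ₜ[ℤ] ρ.1 ∈ σ.1
  · rw [hm ρ h, pow_zero]
    exact one_mem _
  · exact pow_mem (show MvPolynomial.X ρ ∈ denoms K σ from
      Submonoid.subset_closure ⟨ρ, h, rfl⟩) _

/-- On a cone of the fan, each coroot has constant sign. -/
theorem coroot_nonneg_or_nonpos (σ : fan P ΦM) (i : ι) :
    (∀ ρ : Ray P ΦM, (1 : ℝ) ⊗ₜ[ℤ] ρ.1 ∈ σ.1 → 0 ≤ P.toLinearMap ρ.1 (P.coroot i)) ∨
      ∀ ρ : Ray P ΦM, (1 : ℝ) ⊗ₜ[ℤ] ρ.1 ∈ σ.1 → P.toLinearMap ρ.1 (P.coroot i) ≤ 0 := by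
  obtain ⟨_, Ψ, ⟨μ, hμ⟩, -, rfl⟩ := σ
  have hev (j : ι) (x : X) :
      corootEval P j ((1 : ℝ) ⊗ₜ[ℤ] x) = (P.toLinearMap x (P.coroot j) : ℝ) := by
    change TensorProduct.rid ℤ ℝ ((1 : ℝ) ⊗ₜ[ℤ] P.coroot' j x) = _
    rw [TensorProduct.rid_tmul]
    simp
  have hpos (j : ι) (hj : j ∈ Ψ) (x : X) (hx : (1 : ℝ) ⊗ₜ[ℤ] x ∈ cone P Ψ) :
      0 ≤ P.toLinearMap x (P.coroot j) := by
    have h : 0 ≤ corootEval P j ((1 : ℝ) ⊗ₜ[ℤ] x) := by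
      by_cases hn : neg P j ∈ Ψ
      · exact (hx.2.2 j ⟨hj, hn⟩).ge
      · exact hx.2.1 j ⟨hj, hn⟩
    rw [hev] at h
    exact_mod_cast h
  by_cases hi : i ∈ Ψ
  · exact Or.inl fun ρ hρ => hpos i hi ρ.1 hρ
  · have hn : neg P i ∈ Ψ := by
      rw [hμ, Set.mem_ofPred_eq] at hi ⊢
      rw [neg, RootPairing.root_reflectionPerm, RootPairing.reflection_apply_self, map_neg,
        LinearMap.neg_apply]
      lia
    refine Or.inr fun ρ hρ => ?_
    have h := hpos _ hn ρ.1 hρ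
    rw [neg, RootPairing.coroot_reflectionPerm, RootPairing.coreflection_apply_self, map_neg] at h
    lia

variable [Finite ι] [Module.Free ℤ X]

omit [Finite ι] [Module.Free ℤ X] in
theorem weight_rayClass (m : Ray P ΦM →₀ ℕ) :
    Finsupp.weight (rayClass P ΦM) m = Submodule.Quotient.mk fun ρ => (m ρ : ℤ) := by
  classical
  induction m using Finsupp.induction_linear with
  | zero => rw [map_zero]; rfl
  | add m m' h h' =>
    rw [map_add, h, h', ← Submodule.Quotient.mk_add]
    exact congrArg _ (funext fun ρ => by simp)
  | single ρ a =>
    rw [Finsupp.weight_single, rayClass, ← Submodule.Quotient.mk_smul]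
    refine congrArg _ (funext fun ρ' => ?_)
    by_cases h : ρ' = ρ
    · subst h; simp
    · simp [h]

/-- The degree of `y_+^λ` and of `y_-^λ`. -/
def plusClass (P : RootDatum ι X Y) (ΦM : Set ι) (l : Y) : ClassGp P ΦM :=
  Submodule.Quotient.mk fun ρ => ((P.toLinearMap ρ.1 l).toNat : ℤ)

theorem plusMonomial_mem (l : Y) (a : GroupAlg K P ΦM) :
    (MvPolynomial.monomial (Finsupp.equivFunOnFinite.symm fun ρ : Ray P ΦM =>
      (P.toLinearMap ρ.1 l).toNat) a : Cox K P ΦM) ∈ coxGrading K P ΦM (plusClass P ΦM l) :=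
  MvPolynomial.isWeightedHomogeneous_monomial _ _ _ (weight_rayClass _)

variable (pr : Y →ₗ[ℤ] XS P ΦM)

theorem yMinus_mem (l : Y) :
    yMinus K P ΦM l ∈ coxGrading K P ΦM (plusClass P ΦM l) := by
  refine MvPolynomial.isWeightedHomogeneous_monomial _ _ _ ((weight_rayClass _).trans ?_)
  rw [plusClass, Submodule.Quotient.eq]
  refine ⟨-l, funext fun ρ => ?_⟩
  simp only [divisor, LinearMap.pi_apply, map_neg, Pi.sub_apply, Finsupp.equivFunOnFinite_symm_apply_apply]
  lia

theorem rootElt_mem (i : ι) :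
    rootElt K pr i ∈ coxGrading K P ΦM (plusClass P ΦM (P.coroot i)) :=
  sub_mem (plusMonomial_mem K _ _) (yMinus_mem K _)

theorem exists_denom_plusClass (σ : fan P ΦM) (i : ι) :
    ∃ u ∈ coxGrading K P ΦM (plusClass P ΦM (P.coroot i)), u ∈ denoms K σ := by
  rcases coroot_nonneg_or_nonpos σ i with h | h
  · exact ⟨_, yMinus_mem K _, monomial_mem_denoms K fun ρ hρ => by simpa using h ρ hρ⟩
  · exact ⟨_, plusMonomial_mem K _ 1, monomial_mem_denoms K fun ρ hρ => by simpa using h ρ hρ⟩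

end Monomials

/-! ### Maps of sheaves that are invertible up to a function -/

section ChartBack

variable {K : Type} [Field K]
variable {ι X Y : Type u} [AddCommGroup X] [AddCommGroup Y] {P : RootDatum ι X Y} {ΦM : Set ι}
variable {M M' : Type u} [AddCommGroup M] [Module (Cox K P ΦM) M]
variable [AddCommGroup M'] [Module (Cox K P ΦM) M']
variable {gr : ClassGp P ΦM → AddSubgroup M} [SetLike.GradedSMul (coxGrading K P ΦM) gr]
variable {gr' : ClassGp P ΦM → AddSubgroup M'} [SetLike.GradedSMul (coxGrading K P ΦM) gr']
variable (sM : Multiplicative (XS P ΦM) →* Kˣ) (c : ClassGp P ΦM) (n : ℕ) (σ : fan P ΦM)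

theorem mk_one_smul_map (t : M' →ₗ[Cox K P ΦM] M) (u : denoms K σ) (m : M') (f : denoms K σ) :
    (Localization.mk 1 u : Localization (denoms K σ)) •
      LocalizedModule.map (denoms K σ) t (LocalizedModule.mk m f) =
        LocalizedModule.mk (t m) (u * f) := by
  rw [LocalizedModule.map_mk, LocalizedModule.mk_smul_mk, one_smul]

/-- The map on charts `m / f ↦ t(m) / (u f)`, for a map `t` which raises degrees by `deg u`. -/
def chartModuleBack {d : ClassGp P ΦM} (t : M' →ₗ[Cox K P ΦM] M)
    (ht : ∀ e, ∀ m ∈ gr' e, t m ∈ gr (d + e)) (u : coxGrading K P ΦM d)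
    (hu : (u : Cox K P ΦM) ∈ denoms K σ) :
    chartModule K gr' c σ →ₗ[ChartRing K σ] chartModule K gr c σ where
  toFun x := ⟨(Localization.mk 1 ⟨u, hu⟩ : Localization (denoms K σ)) •
      LocalizedModule.map (denoms K σ) t x.1, by
    obtain ⟨_, e, f, hf, m, hm, rfl⟩ := x
    refine ⟨d + e, ⟨u, hu⟩ * f, SetLike.mul_mem_graded u.2 hf, t m, ?_, mk_one_smul_map σ t _ m f⟩
    rw [show c + (d + e) = d + (c + e) by abel]
    exact ht _ _ hm⟩
  map_add' x y := Subtype.ext (by simp)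
  map_smul' z x := Subtype.ext (by
    refine (congrArg _ ((LocalizedModule.map (denoms K σ) t).map_smul
      (algebraMap _ (Localization (denoms K σ)) z) x.1)).trans ?_
    exact smul_comm (Localization.mk 1 ⟨u, hu⟩ : Localization (denoms K σ))
      (algebraMap (ChartRing K σ) (Localization (denoms K σ)) z)
      (LocalizedModule.map (denoms K σ) t x.1))

/-- `chartModuleBack` on the reductions modulo a power of the ideal of the fibre. -/
def truncBack {d : ClassGp P ΦM} (t : M' →ₗ[Cox K P ΦM] M)
    (ht : ∀ e, ∀ m ∈ gr' e, t m ∈ gr (d + e)) (u : coxGrading K P ΦM d)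
    (hu : (u : Cox K P ΦM) ∈ denoms K σ) :
    Trunc gr' sM c n σ →ₗ[ChartRing K σ] Trunc gr sM c n σ :=
  Submodule.mapQ _ _ (chartModuleBack c σ t ht u hu)
    (pow_smul_top_le_comap _ (Ideal.map_id _).le n)

theorem truncMap_truncBack {d : ClassGp P ΦM} {g : M →ₗ[Cox K P ΦM] M'}
    (hg : ∀ e, ∀ m ∈ gr e, g m ∈ gr' e) {t : M' →ₗ[Cox K P ΦM] M}
    (ht : ∀ e, ∀ m ∈ gr' e, t m ∈ gr (d + e)) (F u : coxGrading K P ΦM d)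
    (hu : (u : Cox K P ΦM) ∈ denoms K σ) (hgt : ∀ m, g (t m) = (F : Cox K P ΦM) • m)
    (x : Trunc gr' sM c n σ) :
    truncMap sM c n σ g hg (truncBack sM c n σ t ht u hu x) =
      (HomogeneousLocalization.mk ⟨d, F, u, hu⟩ : ChartRing K σ) • x := by
  obtain ⟨⟨_, e, f, hf, m, hm, rfl⟩, rfl⟩ := Submodule.Quotient.mk_surjective _ x
  refine congrArg Submodule.Quotient.mk (Subtype.ext ?_)
  change LocalizedModule.map (denoms K σ) g ((Localization.mk 1 ⟨u, hu⟩ : Localization (denoms K σ)) •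
    LocalizedModule.map (denoms K σ) t (LocalizedModule.mk m f)) =
      (HomogeneousLocalization.mk ⟨d, F, u, hu⟩ : ChartRing K σ) • LocalizedModule.mk m f
  rw [mk_one_smul_map, LocalizedModule.map_mk, mk_smul_mk, hgt]

theorem truncBack_truncMap {d : ClassGp P ΦM} {g : M →ₗ[Cox K P ΦM] M'}
    (hg : ∀ e, ∀ m ∈ gr e, g m ∈ gr' e) {t : M' →ₗ[Cox K P ΦM] M}
    (ht : ∀ e, ∀ m ∈ gr' e, t m ∈ gr (d + e)) (F u : coxGrading K P ΦM d)
    (hu : (u : Cox K P ΦM) ∈ denoms K σ) (htg : ∀ m, t (g m) = (F : Cox K P ΦM) • m)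
    (x : Trunc gr sM c n σ) :
    truncBack sM c n σ t ht u hu (truncMap sM c n σ g hg x) =
      (HomogeneousLocalization.mk ⟨d, F, u, hu⟩ : ChartRing K σ) • x := by
  obtain ⟨⟨_, e, f, hf, m, hm, rfl⟩, rfl⟩ := Submodule.Quotient.mk_surjective _ x
  refine congrArg Submodule.Quotient.mk (Subtype.ext ?_)
  change (Localization.mk 1 ⟨u, hu⟩ : Localization (denoms K σ)) • LocalizedModule.map (denoms K σ) t
    (LocalizedModule.map (denoms K σ) g (LocalizedModule.mk m f)) =
      (HomogeneousLocalization.mk ⟨d, F, u, hu⟩ : ChartRing K σ) • LocalizedModule.mk m f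
  rw [LocalizedModule.map_mk, mk_one_smul_map, mk_smul_mk, htg]

end ChartBack

section Sections

open StructureSheaf

variable {R N N' : Type u} [CommRing R] [AddCommGroup N] [Module R N] [AddCommGroup N'] [Module R N']

instance isPrime_asIdeal_top (p : PrimeSpectrum.Top R) : (PrimeSpectrum.asIdeal p).IsPrime :=
  PrimeSpectrum.isPrime p

/-- A map of modules is invertible up to a function at a prime `p` if it has an inverse up to the
multiplication by an element which is not in `p`. -/
def InvertibleAt (f : N →ₗ[R] N') (p : PrimeSpectrum R) : Prop :=
  ∃ h ∉ p.asIdeal, ∃ t : N' →ₗ[R] N, (∀ x, t (f x) = h • x) ∧ ∀ y, f (t y) = h • y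

theorem comapₗ_apply_of_eq_mk (f : N →ₗ[R] N') (U : Opens (PrimeSpectrum.Top R))
    (s : (structureSheafInType R N).obj.obj (op U)) (p : U) (a : N) (b : p.1.asIdeal.primeCompl)
    (hs : s.1 p = LocalizedModule.mk a b) :
    (comapₗ f U U (fun _ h => h) s).1 p = LocalizedModule.mk (f a) b := by
  change Localizations.comapFun f p.1 (s.1 p) = _
  rw [hs]
  exact Localizations.comapFun_mk f p.1 a b

theorem comapₗ_injective_of_invertibleAt {f : N →ₗ[R] N'} {U : Opens (PrimeSpectrum.Top R)}
    (hf : ∀ p ∈ U, InvertibleAt f p) : Function.Injective (comapₗ f U U fun _ h => h) := by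
  rw [injective_iff_map_eq_zero]
  intro s hs
  refine Subtype.ext (funext fun p => ?_)
  obtain ⟨h, hp, t, htf, -⟩ := hf p.1 p.2
  obtain ⟨⟨a, b⟩, hab⟩ : ∃ x : N × p.1.asIdeal.primeCompl, s.1 p = LocalizedModule.mk x.1 x.2 := by
    generalize s.1 p = z
    induction z using LocalizedModule.induction_on with
    | h m s => exact ⟨(m, s), rfl⟩
  have h0 : (comapₗ f U U (fun _ h => h) s).1 p = LocalizedModule.mk (f a) b :=
    comapₗ_apply_of_eq_mk f U s p a b hab
  rw [hs] at h0
  have h1 : LocalizedModule.mk (f a) b = LocalizedModule.mk 0 1 :=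
    h0.symm.trans (LocalizedModule.zero_mk 1).symm
  obtain ⟨r, hr⟩ := LocalizedModule.mk_eq.1 h1
  refine hab.trans (Eq.trans (LocalizedModule.mk_eq.2 ⟨r * ⟨h, hp⟩, ?_⟩) (LocalizedModule.zero_mk 1))
  have h2 := congrArg t hr
  simp only [Submonoid.smul_def, map_smul, htf, one_smul, smul_zero, map_zero, mul_smul] at h2 ⊢
  exact h2

theorem comapₗ_surjective_of_invertibleAt {f : N →ₗ[R] N'} {U : Opens (PrimeSpectrum.Top R)}
    (hf : ∀ p ∈ U, InvertibleAt f p) : Function.Surjective (comapₗ f U U fun _ h => h) := by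
  intro s'
  -- near each point the preimage is a fraction
  have key : ∀ p : U, ∃ (V : Opens (PrimeSpectrum.Top R)) (_ : p.1 ∈ V) (_ : V ≤ U)
      (a : N) (b : R) (hb : V ≤ PrimeSpectrum.basicOpen b), ∀ q : U, ∀ hq : q.1 ∈ V,
        s'.1 q = LocalizedModule.mk (f a) ⟨b, hb hq⟩ := by
    intro p
    obtain ⟨V, hpV, i, a, b, hab⟩ := s'.2 p
    obtain ⟨h, hp, t, -, hft⟩ := hf p.1 p.2
    refine ⟨V ⊓ PrimeSpectrum.basicOpen h, ⟨hpV, hp⟩, inf_le_left.trans i.le, t a, h * b,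
      fun q hq => ?_, fun q hq => ?_⟩
    · exact Submonoid.mul_mem (PrimeSpectrum.asIdeal q).primeCompl hq.2 (hab ⟨q, hq.1⟩).1
    · obtain ⟨hb, h1⟩ := hab ⟨q.1, hq.1⟩
      refine h1.trans ?_
      rw [hft]
      exact (LocalizedModule.mk_cancel_common_left (⟨h, hq.2⟩ : q.1.asIdeal.primeCompl)
        ⟨b, hb⟩ a).symm
  choose V hpV hVU a b hb hs' using key
  let s : ∀ p : U, Localizations N p.1 := fun p =>
    LocalizedModule.mk (a p) ⟨b p, hb p (hpV p)⟩
  have hs : ∀ p q : U, ∀ hq : q.1 ∈ V p,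
      s q = LocalizedModule.mk (a p) ⟨b p, hb p hq⟩ := by
    intro p q hq
    -- both sides have the same image, and `f` is injective on the stalk
    have h1 : (LocalizedModule.mk (f (a q)) ⟨b q, hb q (hpV q)⟩ : Localizations N' q.1) =
      LocalizedModule.mk (f (a p)) ⟨b p, hb p hq⟩ := (hs' q q (hpV q)).symm.trans (hs' p q hq)
    obtain ⟨h, hp, t, htf, -⟩ := hf q.1 q.2
    obtain ⟨r, hr⟩ := LocalizedModule.mk_eq.1 h1
    refine LocalizedModule.mk_eq.2 ⟨r * ⟨h, hp⟩, ?_⟩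
    have h2 := congrArg t hr
    simp only [Submonoid.smul_def, map_smul, htf] at h2 ⊢
    simp only [Submonoid.coe_mul, mul_smul]
    rw [smul_comm h, smul_comm h]
    exact h2
  refine ⟨⟨s, fun p => ⟨V p, hpV p, homOfLE (hVU p), a p, b p, fun q =>
    ⟨hb p q.2, hs p ⟨q.1, hVU p q.2⟩ q.2⟩⟩⟩, Subtype.ext (funext fun p => ?_)⟩
  exact (comapₗ_apply_of_eq_mk f U _ p (a p) ⟨b p, hb p (hpV p)⟩ rfl).trans
    (hs' p p (hpV p)).symm

theorem comapₗ_bijective_of_invertibleAt {f : N →ₗ[R] N'} {U : Opens (PrimeSpectrum.Top R)}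
    (hf : ∀ p ∈ U, InvertibleAt f p) : Function.Bijective (comapₗ f U U fun _ h => h) :=
  ⟨comapₗ_injective_of_invertibleAt hf, comapₗ_surjective_of_invertibleAt hf⟩

end Sections

/-! ### Points of the fibre and elements of the dual torus -/

section Characters

/-- A homomorphism to a divisible group that is given by its graph on a submonoid extends to the
whole group. -/
theorem exists_addMonoidHom_of_graph {L B : Type*} [AddCommGroup L] [AddCommGroup B]
    [DivisibleBy B ℤ] (Q : AddSubmonoid (L × B))
    (hQ : ∀ l z z', (l, z) ∈ Q → (l, z') ∈ Q → z = z') :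
    ∃ s : L →+ B, ∀ q ∈ Q, s q.1 = q.2 := by
  let G := AddSubgroup.closure (Q : Set (L × B))
  have hG : ∀ x ∈ G, ∃ a ∈ Q, ∃ b ∈ Q, x = a - b := by
    intro x hx
    induction hx using AddSubgroup.closure_induction with
    | mem x h => exact ⟨x, h, 0, zero_mem _, (sub_zero x).symm⟩
    | zero => exact ⟨0, zero_mem _, 0, zero_mem _, (sub_zero 0).symm⟩
    | add x y _ _ hx hy =>
      obtain ⟨a, ha, b, hb, rfl⟩ := hx
      obtain ⟨a', ha', b', hb', rfl⟩ := hy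
      exact ⟨a + a', add_mem ha ha', b + b', add_mem hb hb', by abel⟩
    | neg x _ hx =>
      obtain ⟨a, ha, b, hb, rfl⟩ := hx
      exact ⟨b, hb, a, ha, by abel⟩
  have hinj : Function.Injective ((AddMonoidHom.fst L B).comp G.subtype) := by
    rw [injective_iff_map_eq_zero]
    rintro ⟨x, hx⟩ h0
    obtain ⟨⟨l, z⟩, ha, ⟨l', z'⟩, hb, rfl⟩ := hG x hx
    have hl : l = l' := sub_eq_zero.1 h0
    subst hl
    have hz := hQ l z z' ha hb
    subst hz
    exact Subtype.ext (sub_self _)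
  obtain ⟨s, hs⟩ := (Module.Baer.of_divisible B).extension_property_addMonoidHom
    ((AddMonoidHom.fst L B).comp G.subtype) hinj ((AddMonoidHom.snd L B).comp G.subtype)
  exact ⟨s, fun q hq => DFunLike.congr_fun hs (⟨q, AddSubgroup.subset_closure hq⟩ : G)⟩

/-- The multiplicative group of an algebraically closed field is divisible. -/
@[reducible] def divisibleByUnits (K : Type*) [Field K] [IsAlgClosed K] :
    DivisibleBy (Additive Kˣ) ℤ :=
  letI : DivisibleBy (Additive Kˣ) ℕ := divisibleByOfSMulRightSurj _ _ fun {n} hn z => by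
    obtain ⟨y, hy⟩ := IsAlgClosed.exists_pow_nat_eq (z.toMul : K) (Nat.pos_of_ne_zero hn)
    have hy0 : y ≠ 0 := by
      rintro rfl
      rw [zero_pow hn] at hy
      exact z.toMul.ne_zero hy.symm
    exact ⟨Additive.ofMul (Units.mk0 y hy0), Additive.toMul.injective (Units.ext hy)⟩
  AddGroup.divisibleByIntOfDivisibleByNat _

variable {K : Type} [Field K] [IsAlgClosed K]
variable {ι X Y : Type u} [AddCommGroup X] [AddCommGroup Y] {P : RootDatum ι X Y} {ΦM : Set ι}

theorem exists_liesOver (sM : Multiplicative (XS P ΦM) →* Kˣ) : ∃ s, LiesOver s sM := by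
  let := divisibleByUnits K
  obtain ⟨s, hs⟩ := (Module.Baer.of_divisible (Additive Kˣ)).extension_property_addMonoidHom
    (XS P ΦM).subtype.toAddMonoidHom Subtype.val_injective (MonoidHom.toAdditiveRight sM)
  exact ⟨AddMonoidHom.toMultiplicativeLeft s, fun l => DFunLike.congr_fun hs l⟩

end Characters

section Fibre

variable (K : Type) [Field K]
variable {ι X Y : Type u} [AddCommGroup X] [AddCommGroup Y] (P : RootDatum ι X Y) (ΦM : Set ι)

/-- The function on `Ŝ` defined by a cocharacter of `S`. -/
def grpElt (l : XS P ΦM) : GroupAlg K P ΦM := (AddMonoidAlgebra.single l 1 : AddMonoidAlgebra K _)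

theorem grpElt_zero : grpElt K P ΦM 0 = 1 := rfl

theorem grpElt_add (l l' : XS P ΦM) :
    grpElt K P ΦM (l + l') = grpElt K P ΦM l * grpElt K P ΦM l' := by
  refine Eq.symm ((AddMonoidAlgebra.single_mul_single ..).trans ?_)
  rw [one_mul]
  rfl

variable {K P ΦM}

theorem evalS_grpElt (sM : Multiplicative (XS P ΦM) →* Kˣ) (l : XS P ΦM) :
    evalS K sM (grpElt K P ΦM l) = sM (Multiplicative.ofAdd l) := by
  refine (AddMonoidAlgebra.lift_single ..).trans ?_
  rw [one_smul]
  rfl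

theorem evalS_algebraMap (sM : Multiplicative (XS P ΦM) →* Kˣ) (z : K) :
    evalS K sM (algebraMap K (GroupAlg K P ΦM) z) = z :=
  (AddMonoidAlgebra.lift K K (XS P ΦM) ((Units.coeHom K).comp sM)).commutes z

/-- The constant functions on the chart `U_σ`. -/
def chartConst (σ : fan P ΦM) : K →+* ChartRing K σ :=
  (chartProj K σ).comp (algebraMap K (GroupAlg K P ΦM))

variable (pr : Y →ₗ[ℤ] XS P ΦM)

/-- A cocharacter `λ` is a rational function on `Y`, a quotient of two monomials. The fraction `q` is
of this form and has its denominator among those of the chart `U_σ`, so that the function is regular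
there. Several pairs of monomials are allowed, which makes the notion multiplicative. -/
def IsMonomialFraction (σ : fan P ΦM) (l : Y)
    (q : HomogeneousLocalization.NumDenSameDeg (coxGrading K P ΦM) (denoms K σ)) : Prop :=
  ∃ m m' : Ray P ΦM →₀ ℕ, (∀ ρ, (m ρ : ℤ) - m' ρ = P.toLinearMap ρ.1 l) ∧
    (q.num : Cox K P ΦM) = MvPolynomial.monomial m (grpElt K P ΦM (pr l)) ∧
    (q.den : Cox K P ΦM) = MvPolynomial.monomial m' 1

theorem IsMonomialFraction.mk_eq {σ : fan P ΦM} {l : Y}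
    {q q' : HomogeneousLocalization.NumDenSameDeg (coxGrading K P ΦM) (denoms K σ)}
    (h : IsMonomialFraction pr σ l q) (h' : IsMonomialFraction pr σ l q') :
    (HomogeneousLocalization.mk q : ChartRing K σ) = HomogeneousLocalization.mk q' := by
  obtain ⟨m₁, m₂, hm, h₁, h₂⟩ := h
  obtain ⟨m₁', m₂', hm', h₁', h₂'⟩ := h'
  apply HomogeneousLocalization.val_injective
  rw [HomogeneousLocalization.val_mk, HomogeneousLocalization.val_mk, Localization.mk_eq_mk_iff,
    Localization.r_iff_exists]
  refine ⟨1, congrArg _ ?_⟩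
  change (q'.den : Cox K P ΦM) * q.num = q.den * q'.num
  rw [h₁, h₂, h₁', h₂', MvPolynomial.monomial_mul, MvPolynomial.monomial_mul]
  refine congrArg (fun a => MvPolynomial.monomial a _) (Finsupp.ext fun ρ => ?_)
  have h1 := hm ρ
  have h2 := hm' ρ
  simp only [Finsupp.add_apply]
  lia

theorem IsMonomialFraction.mul {σ : fan P ΦM} {l l' : Y}
    {q q' : HomogeneousLocalization.NumDenSameDeg (coxGrading K P ΦM) (denoms K σ)}
    (h : IsMonomialFraction pr σ l q) (h' : IsMonomialFraction pr σ l' q') :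
    IsMonomialFraction pr σ (l + l') (q * q') := by
  obtain ⟨m₁, m₂, hm, h₁, h₂⟩ := h
  obtain ⟨m₁', m₂', hm', h₁', h₂'⟩ := h'
  refine ⟨m₁ + m₁', m₂ + m₂', fun ρ => ?_, ?_, ?_⟩
  · rw [map_add, ← hm, ← hm']
    simp only [Finsupp.add_apply]
    push_cast
    ring
  · change (q.num : Cox K P ΦM) * q'.num = _
    rw [h₁, h₁', MvPolynomial.monomial_mul, map_add, grpElt_add]
  · change (q.den : Cox K P ΦM) * q'.den = _
    rw [h₂, h₂', MvPolynomial.monomial_mul, one_mul]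

theorem isMonomialFraction_one (σ : fan P ΦM) : IsMonomialFraction (K := K) pr σ 0 1 := by
  refine ⟨0, 0, by simp, ?_, ?_⟩
  · rw [map_zero, grpElt_zero]; rfl
  · rfl

/-- The pairs `(λ, z)` such that the function defined by the cocharacter `λ` is regular on `U_σ` and
takes the constant value `z ∈ K^×` at the point `p`. -/
def valueGraph {σ : fan P ΦM} (p : Ideal (ChartRing K σ)) : AddSubmonoid (Y × Additive Kˣ) where
  carrier := {x | ∃ q, IsMonomialFraction pr σ x.1 q ∧
    HomogeneousLocalization.mk q - chartConst σ (x.2.toMul : K) ∈ p}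
  zero_mem' := ⟨1, isMonomialFraction_one pr σ, by
    change (1 : ChartRing K σ) - chartConst σ 1 ∈ p
    rw [map_one, sub_self]
    exact zero_mem _⟩
  add_mem' := by
    rintro ⟨l, z⟩ ⟨l', z'⟩ ⟨q, hq, h⟩ ⟨q', hq', h'⟩
    refine ⟨q * q', hq.mul pr hq', ?_⟩
    change (HomogeneousLocalization.mk q : ChartRing K σ) * HomogeneousLocalization.mk q' -
      chartConst σ ((z.toMul : K) * (z'.toMul : K)) ∈ p
    rw [map_mul, show ∀ a b c d : ChartRing K σ, a * b - c * d = a * (b - d) + d * (a - c) by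
      intros; ring]
    exact add_mem (Ideal.mul_mem_left _ _ h') (Ideal.mul_mem_left _ _ h)

/-- Two values of the same cocharacter at `p` agree, since their difference is a constant in `p`. -/
theorem eq_of_mem_valueGraph {σ : fan P ΦM} {p : Ideal (ChartRing K σ)} (hp : p ≠ ⊤) {l : Y}
    {z z' : Additive Kˣ} (h : (l, z) ∈ valueGraph pr p) (h' : (l, z') ∈ valueGraph pr p) :
    z = z' := by
  obtain ⟨q, hq, h⟩ := h
  obtain ⟨q', hq', h'⟩ := h'
  rw [hq.mk_eq pr hq'] at h
  have h1 : chartConst σ ((z.toMul : K) - (z'.toMul : K)) ∈ p := by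
    have h2 := sub_mem h' h
    rw [sub_sub_sub_cancel_left] at h2
    rw [map_sub]
    exact h2
  by_contra hne
  have h3 : (z.toMul : K) - (z'.toMul : K) ≠ 0 :=
    sub_ne_zero.2 fun h => hne (Additive.toMul.injective (Units.ext h))
  exact hp (Ideal.eq_top_of_isUnit_mem _ h1 ((isUnit_iff_ne_zero.2 h3).map _))

theorem mem_valueGraph_of_mem_XS (hpr : ∀ x : XS P ΦM, pr (x : Y) = x)
    {sM : Multiplicative (XS P ΦM) →* Kˣ} {σ : fan P ΦM} {p : Ideal (ChartRing K σ)}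
    (hp : fibreIdeal sM σ ≤ p) (l : XS P ΦM) :
    ((l : Y), Additive.ofMul (sM (Multiplicative.ofAdd l))) ∈ valueGraph pr p := by
  refine ⟨⟨0, constHom K (grpElt K P ΦM l), 1, one_mem _⟩, ⟨0, 0, fun ρ => ?_, ?_, rfl⟩, ?_⟩
  · have h := congrFun (LinearMap.mem_ker.1 l.2) ρ
    simpa [divisor] using h.symm
  · rw [hpr]; rfl
  · apply hp
    have h : grpElt K P ΦM l - algebraMap K _ (sM (Multiplicative.ofAdd l) : K) ∈
        RingHom.ker (evalS K sM) := by
      rw [RingHom.mem_ker, map_sub, evalS_grpElt, evalS_algebraMap, sub_self]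
    have h2 := Ideal.mem_map_of_mem (chartProj K σ) h
    rw [map_sub] at h2
    exact h2

variable [Finite ι] [Module.Free ℤ X]

/-- If `y_+^{α^∨} - y_-^{α^∨}` vanishes at `p`, then `α^∨` takes the value `1` at `p`. The function that is
regular on the chart is `α^∨` or `-α^∨`, according to the sign of `α^∨` on the cone. -/
theorem coroot_mem_valueGraph {σ : fan P ΦM} {p : PrimeSpectrum (ChartRing K σ)} {i : ι}
    (hi : p ∉ nonvanishing K σ (⟨rootElt K pr i, rootElt_mem K pr i⟩ : coxGrading K P ΦM _)) :
    (P.coroot i, (0 : Additive Kˣ)) ∈ valueGraph pr p.asIdeal ∨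
      (-P.coroot i, (0 : Additive Kˣ)) ∈ valueGraph pr p.asIdeal := by
  have hmem : ∀ u : coxGrading K P ΦM _, ∀ hu : (u : Cox K P ΦM) ∈ denoms K σ,
      (HomogeneousLocalization.mk ⟨_, ⟨rootElt K pr i, rootElt_mem K pr i⟩, u, hu⟩ :
        ChartRing K σ) ∈ p.asIdeal := by
    intro u hu
    by_contra h
    exact hi ⟨u, hu, h⟩
  rcases coroot_nonneg_or_nonpos σ i with h | h
  · left
    have hden : yMinus K P ΦM (P.coroot i) ∈ denoms K σ :=
      monomial_mem_denoms K fun ρ hρ => by simpa using h ρ hρ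
    refine ⟨⟨_, ⟨yPlus K pr (P.coroot i), plusMonomial_mem K _ _⟩,
      ⟨yMinus K P ΦM (P.coroot i), yMinus_mem K _⟩, hden⟩, ⟨_, _, fun ρ => ?_, rfl, rfl⟩, ?_⟩
    · simp only [Finsupp.equivFunOnFinite_symm_apply_apply]
      lia
    · convert hmem ⟨yMinus K P ΦM (P.coroot i), yMinus_mem K _⟩ hden using 1
      change _ - chartConst σ 1 = _
      rw [map_one]
      apply HomogeneousLocalization.val_injective
      rw [HomogeneousLocalization.val_sub, HomogeneousLocalization.val_one,
        HomogeneousLocalization.val_mk, HomogeneousLocalization.val_mk]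
      simp only [rootElt]
      rw [← Localization.mk_self ⟨_, hden⟩, Localization.sub_mk]
      rw [Localization.mk_eq_mk_iff, Localization.r_iff_exists]
      exact ⟨1, by simp only [Submonoid.coe_mul]; ring⟩
  · right
    set u : Cox K P ΦM := MvPolynomial.monomial (Finsupp.equivFunOnFinite.symm
      fun ρ : Ray P ΦM => (P.toLinearMap ρ.1 (P.coroot i)).toNat) 1 with hu
    have hden : u ∈ denoms K σ := monomial_mem_denoms K fun ρ hρ => by simpa using h ρ hρ
    have hud : u ∈ coxGrading K P ΦM (plusClass P ΦM (P.coroot i)) := plusMonomial_mem K _ _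
    have hg := grpElt_add K P ΦM (pr (-P.coroot i)) (pr (P.coroot i))
    rw [← map_add, neg_add_cancel, map_zero, grpElt_zero] at hg
    have hplus : MvPolynomial.C (grpElt K P ΦM (pr (-P.coroot i))) * yPlus K pr (P.coroot i) = u := by
      refine (MvPolynomial.C_mul_monomial).trans ?_
      rw [hu, hg]
      rfl
    have hnd : MvPolynomial.C (grpElt K P ΦM (pr (-P.coroot i))) * yMinus K P ΦM (P.coroot i) ∈
        coxGrading K P ΦM (plusClass P ΦM (P.coroot i)) := by
      have h := SetLike.mul_mem_graded (C_mem K (grpElt K P ΦM (pr (-P.coroot i))))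
        (yMinus_mem K (ΦM := ΦM) (P.coroot i))
      rwa [zero_add] at h
    refine ⟨⟨_, ⟨_, hnd⟩, ⟨u, hud⟩, hden⟩, ⟨Finsupp.equivFunOnFinite.symm
      fun ρ : Ray P ΦM => (-P.toLinearMap ρ.1 (P.coroot i)).toNat, _, fun ρ => ?_, ?_, rfl⟩, ?_⟩
    rotate_left
    · refine (MvPolynomial.C_mul_monomial).trans ?_
      rw [mul_one]
    · rw [← neg_mem_iff]
      convert Ideal.mul_mem_left _ (chartProj K σ (grpElt K P ΦM (pr (-P.coroot i))))
        (hmem ⟨u, hud⟩ hden) using 1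
      change -(_ - chartConst σ 1) = _
      rw [map_one]
      apply HomogeneousLocalization.val_injective
      rw [HomogeneousLocalization.val_neg, HomogeneousLocalization.val_sub,
        HomogeneousLocalization.val_one, HomogeneousLocalization.val_mul,
        HomogeneousLocalization.val_mk, HomogeneousLocalization.val_mk]
      change _ = Localization.mk (MvPolynomial.C (grpElt K P ΦM (pr (-P.coroot i)))) 1 * _
      simp only [rootElt]
      rw [← Localization.mk_self ⟨_, hden⟩, Localization.sub_mk, Localization.neg_mk,
        Localization.mk_mul, Localization.mk_eq_mk_iff, Localization.r_iff_exists]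
      refine ⟨1, ?_⟩
      simp only [Submonoid.coe_mul, mul_sub, hplus, OneMemClass.coe_one]
      ring
    · simp only [Finsupp.equivFunOnFinite_symm_apply_apply, map_neg]
      lia

/-- At a point of the fibre over `s_M`, the roots at which `y_+^{α^∨} - y_-^{α^∨}` vanishes are roots of
the centralizer of an element of `T̂` above `s_M`. -/
theorem exists_liesOver_of_fibreIdeal_le [IsAlgClosed K] (hpr : ∀ x : XS P ΦM, pr (x : Y) = x)
    {sM : Multiplicative (XS P ΦM) →* Kˣ} {σ : fan P ΦM} {p : PrimeSpectrum (ChartRing K σ)}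
    (hp : fibreIdeal sM σ ≤ p.asIdeal) :
    ∃ s, LiesOver s sM ∧ ∀ i ∉ centralizerRoots K P s,
      p ∈ nonvanishing K σ (⟨rootElt K pr i, rootElt_mem K pr i⟩ : coxGrading K P ΦM _) := by
  let := divisibleByUnits K
  obtain ⟨s, hs⟩ := exists_addMonoidHom_of_graph (valueGraph pr p.asIdeal)
    fun l z z' h h' => eq_of_mem_valueGraph pr p.2.ne_top h h'
  refine ⟨AddMonoidHom.toMultiplicativeLeft s,
    fun l => hs _ (mem_valueGraph_of_mem_XS pr hpr hp l), fun i hi => ?_⟩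
  by_contra hv
  have h0 : s (P.coroot i) = 0 := by
    rcases coroot_mem_valueGraph pr hv with h | h
    · exact hs _ h
    · have h1 := hs _ h
      rw [map_neg] at h1
      exact neg_eq_zero.1 h1
  exact hi h0

/-- Each point of the fibre over `s_M` has a maximal centralizer such that `y_+^{α^∨} - y_-^{α^∨}` does
not vanish at the point, for the roots `α` outside of it. -/
theorem exists_maximalCentralizers_nonvanishing [IsAlgClosed K]
    (hpr : ∀ x : XS P ΦM, pr (x : Y) = x)
    {sM : Multiplicative (XS P ΦM) →* Kˣ} {σ : fan P ΦM} {p : PrimeSpectrum (ChartRing K σ)}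
    (hp : fibreIdeal sM σ ≤ p.asIdeal) :
    ∃ Ψ ∈ maximalCentralizers sM, ∀ i ∉ Ψ,
      p ∈ nonvanishing K σ (⟨rootElt K pr i, rootElt_mem K pr i⟩ : coxGrading K P ΦM _) := by
  obtain ⟨s, hs, h⟩ := exists_liesOver_of_fibreIdeal_le pr hpr hp
  obtain ⟨Ψ, hle, hΨ⟩ := Set.Finite.exists_le_maximal
    (Set.toFinite {Ψ : Set ι | ∃ s, LiesOver s sM ∧ Ψ = centralizerRoots K P s}) ⟨s, hs, rfl⟩
  exact ⟨Ψ, hΨ, fun i hi => h i fun h' => hi (hle h')⟩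

end Fibre

/-! ### Open subsets of the toric variety -/

section ColimitOpens

variable (K : Type) [Field K]
variable {ι X Y : Type u} [AddCommGroup X] [AddCommGroup Y] {P : RootDatum ι X Y} {ΦM : Set ι}

/-- The space underlying the toric variety is the colimit of the spaces underlying the charts. -/
def isColimitForget : Limits.IsColimit
    (LocallyRingedSpace.forgetToTop.mapCocone (Limits.colimit.cocone (chartDiagram K P ΦM))) :=
  have : Limits.PreservesColimits LocallyRingedSpace.forgetToTop.{u} :=
    Limits.comp_preservesColimits _ _
  Limits.isColimitOfPreserves _ (Limits.colimit.isColimit _)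

theorem exists_chartIncl_eq (y : toricVariety K P ΦM) :
    ∃ (σ : fan P ΦM) (p : PrimeSpectrum (ChartRing K σ)), (chartIncl K σ).base p = y := by
  obtain ⟨σ, p, hp⟩ := Limits.Concrete.isColimit_exists_rep _ (isColimitForget K (P := P) (ΦM := ΦM)) y
  exact ⟨σ, p, hp⟩

/-- Compatible open subsets of the charts are the traces of an open subset of the toric variety. -/
theorem exists_opens_of_charts (V : ∀ σ : fan P ΦM, Set (PrimeSpectrum (ChartRing K σ)))
    (hV : ∀ σ, IsOpen (V σ))
    (hVV : ∀ (τ σ : fan P ΦM) (h : τ ≤ σ) (p : PrimeSpectrum (ChartRing K τ)),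
      PrimeSpectrum.comap (chartRes K h) p ∈ V σ ↔ p ∈ V τ) :
    ∃ U : Opens (toricVariety K P ΦM), ∀ (σ : fan P ΦM) (p : PrimeSpectrum (ChartRing K σ)),
      (chartIncl K σ).base p ∈ U ↔ p ∈ V σ := by
  -- the characteristic functions glue to a continuous map to the Sierpinski space
  let c : Limits.Cocone (chartDiagram K P ΦM ⋙ LocallyRingedSpace.forgetToTop) :=
    { pt := TopCat.of (ULift.{u} Prop)
      ι :=
        { app := fun σ => TopCat.ofHom ⟨fun p : PrimeSpectrum (ChartRing K σ) => ULift.up (p ∈ V σ),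
            continuous_uliftUp.comp (continuous_Prop.2 (hV σ))⟩
          naturality := fun τ σ f => TopCat.hom_ext (ContinuousMap.ext fun p =>
            congrArg ULift.up (propext (hVV τ σ (leOfHom f) p))) } }
  let χ := (isColimitForget K (P := P) (ΦM := ΦM)).desc c
  have hχ : Continuous fun y => (χ y).down := continuous_uliftDown.comp χ.hom.continuous
  refine ⟨⟨{y | (χ y).down}, continuous_Prop.1 hχ⟩, fun σ p => ?_⟩
  have h := DFunLike.congr_fun (congrArg TopCat.Hom.hom
    ((isColimitForget K (P := P) (ΦM := ΦM)).fac c σ)) p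
  exact iff_of_eq (congrArg ULift.down h)

end ColimitOpens

section FibreOpens

variable {K : Type} [Field K]
variable {ι X Y : Type u} [AddCommGroup X] [AddCommGroup Y] {P : RootDatum ι X Y} {ΦM : Set ι}
variable [Finite ι] [Module.Free ℤ X] (pr : Y →ₗ[ℤ] XS P ΦM)
variable (sM : Multiplicative (XS P ΦM) →* Kˣ)

omit [Finite ι] [Module.Free ℤ X] in
theorem map_fibreIdeal {τ σ : fan P ΦM} (h : τ ≤ σ) :
    (fibreIdeal sM σ).map (chartRes K h) = fibreIdeal sM τ := by
  rw [fibreIdeal, Ideal.map_map]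
  rfl

/-- The points of the chart `U_σ` that are outside of the fibre over `s_M`, or at which none of the
functions `y_+^{α^∨} - y_-^{α^∨}` vanishes, for the roots outside of `Ψ`. -/
def goodLocus (Ψ : Set ι) (σ : fan P ΦM) : Set (PrimeSpectrum (ChartRing K σ)) :=
  {p | ¬ fibreIdeal sM σ ≤ p.asIdeal} ∪ ⋂ i ∈ Ψᶜ, nonvanishing K σ
    (⟨rootElt K pr i, rootElt_mem K pr i⟩ : coxGrading K P ΦM _)

theorem isOpen_goodLocus (Ψ : Set ι) (σ : fan P ΦM) : IsOpen (goodLocus pr sM Ψ σ) := by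
  refine IsOpen.union ?_ ((Set.toFinite _).isOpen_biInter fun i _ => isOpen_nonvanishing K σ _)
  exact (PrimeSpectrum.isClosed_zeroLocus (fibreIdeal sM σ : Set (ChartRing K σ))).isOpen_compl

theorem mem_goodLocus_comap (Ψ : Set ι) {τ σ : fan P ΦM} (h : τ ≤ σ)
    (p : PrimeSpectrum (ChartRing K τ)) :
    PrimeSpectrum.comap (chartRes K h) p ∈ goodLocus pr sM Ψ σ ↔ p ∈ goodLocus pr sM Ψ τ := by
  have h1 : fibreIdeal sM σ ≤ (PrimeSpectrum.comap (chartRes K h) p).asIdeal ↔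
      fibreIdeal sM τ ≤ p.asIdeal := by
    rw [← map_fibreIdeal sM h, PrimeSpectrum.comap_asIdeal, Ideal.map_le_iff_le_comap]
  simp only [goodLocus, Set.mem_union, Set.mem_iInter]
  refine or_congr (not_congr h1) (forall_congr' fun i => forall_congr' fun _ => ?_)
  exact mem_nonvanishing_iff_comap h (exists_denom_plusClass K σ i) p

/-- The open subset of the toric variety whose traces on the charts are the sets `goodLocus`. -/
def goodOpens (Ψ : Set ι) : Opens (toricVariety K P ΦM) :=
  (exists_opens_of_charts K (goodLocus pr sM Ψ) (isOpen_goodLocus pr sM Ψ)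
    fun _ _ h p => mem_goodLocus_comap pr sM Ψ h p).choose

theorem chartIncl_mem_goodOpens (Ψ : Set ι) {σ : fan P ΦM} (p : PrimeSpectrum (ChartRing K σ)) :
    (chartIncl K σ).base p ∈ goodOpens pr sM Ψ ↔ p ∈ goodLocus pr sM Ψ σ :=
  (exists_opens_of_charts K (goodLocus pr sM Ψ) (isOpen_goodLocus pr sM Ψ)
    fun _ _ h p => mem_goodLocus_comap pr sM Ψ h p).choose_spec σ p

/-- The open subsets attached to the maximal centralizers cover the toric variety. -/
theorem exists_mem_goodOpens [IsAlgClosed K] (hpr : ∀ x : XS P ΦM, pr (x : Y) = x)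
    (y : toricVariety K P ΦM) : ∃ Ψ ∈ maximalCentralizers sM, y ∈ goodOpens pr sM Ψ := by
  obtain ⟨σ, p, rfl⟩ := exists_chartIncl_eq K y
  by_cases hp : fibreIdeal sM σ ≤ p.asIdeal
  · obtain ⟨Ψ, hΨ, h⟩ := exists_maximalCentralizers_nonvanishing pr hpr hp
    exact ⟨Ψ, hΨ, (chartIncl_mem_goodOpens pr sM Ψ p).2 (Or.inr (Set.mem_iInter₂.2 h))⟩
  · obtain ⟨s, hs⟩ := exists_liesOver sM
    obtain ⟨Ψ, -, hΨ⟩ := Set.Finite.exists_le_maximal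
      (Set.toFinite {Ψ : Set ι | ∃ s, LiesOver s sM ∧ Ψ = centralizerRoots K P s}) ⟨s, hs, rfl⟩
    exact ⟨Ψ, hΨ, (chartIncl_mem_goodOpens pr sM Ψ p).2 (Or.inl hp)⟩

variable (v : ι → ℕ) {Φp : Set ι} [CharZero K] [P.IsReduced]

omit [Finite ι] [Module.Free ℤ X] [CharZero K] [P.IsReduced] in
theorem invertibleAt_of_mem_of_notMem {R N N' : Type u} [CommRing R] [AddCommGroup N] [Module R N]
    [AddCommGroup N'] [Module R N'] {I : Ideal R} {n : ℕ}
    (f : (N ⧸ (I ^ n • ⊤ : Submodule R N)) →ₗ[R] N' ⧸ (I ^ n • ⊤ : Submodule R N'))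
    {p : PrimeSpectrum R} {g : R} (hg : g ∈ I) (hgp : g ∉ p.asIdeal) : InvertibleAt f p := by
  have h0 (L : Type u) [AddCommGroup L] [Module R L] (x : L ⧸ (I ^ n • ⊤ : Submodule R L)) :
      g ^ n • x = 0 := by
    obtain ⟨x, rfl⟩ := Submodule.Quotient.mk_surjective _ x
    rw [← Submodule.Quotient.mk_smul, Submodule.Quotient.mk_eq_zero]
    exact Submodule.smul_mem_smul (Ideal.pow_mem_pow hg n) trivial
  refine ⟨g ^ n, fun h => hgp (p.2.mem_of_pow_mem _ h), 0, fun x => ?_, fun x => ?_⟩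
  · rw [LinearMap.zero_apply, h0]
  · rw [LinearMap.zero_apply, map_zero, h0]

/-- On `goodLocus`, the transfer factor from `H` to a subgroup that contains all the roots of `H` in `Ψ`
is invertible up to a function. -/
theorem invertibleAt_truncMap (hΦp : IsHalfSystem P Φp) {H H' Ψ : Set ι} (hH : H' ⊆ H)
    (hΨ : H ∩ Ψ ⊆ H') (c : ClassGp P ΦM) (n : ℕ) {σ : fan P ΦM}
    {p : PrimeSpectrum (ChartRing K σ)} (hp : p ∈ goodLocus pr sM Ψ σ) :
    InvertibleAt (truncMap (gr := gradedPiece K pr v Φp H) (gr' := gradedPiece K pr v Φp H') sM c n σ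
      (transferLH K pr v Φp H H') fun _ _ hm => transferLH_mem K pr hm) p := by
  rcases hp with hp | hp
  · obtain ⟨g, hg, hgp⟩ := Set.not_subset.1 hp
    -- outside of the fibre both sheaves vanish: they are killed by a power of `g`
    exact invertibleAt_of_mem_of_notMem _ hg hgp
  · obtain ⟨d, hd, u, hu, hF⟩ := exists_prod_mk_notMem p (rootElt K pr) v (rootDiff Φp H H')
      fun i hi => ⟨_, rootElt_mem K pr i, Set.mem_iInter₂.1 hp i fun h =>
        (mem_rootDiff.1 hi).2.2 (hΨ ⟨(mem_rootDiff.1 hi).2.1, h⟩)⟩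
    refine ⟨_, hF, truncBack sM c n σ (backLH K pr v hΦp hH)
      (fun e m hm => backLH_mem K pr v hΦp hH hd hm) u hu, fun x => ?_, fun y => ?_⟩
    · exact truncBack_truncMap sM c n σ _ _ ⟨_, hd⟩ u hu (backLH_transferLH K pr v hΦp hH) x
    · exact truncMap_truncBack sM c n σ _ _ ⟨_, hd⟩ u hu (transferLH_backLH K pr v hΦp hH) y

end FibreOpens

/-! ### Cubical complexes -/

section Cube

variable {n : ℕ} {G : Finset (Fin n) → Type*} [∀ I, AddCommGroup (G I)] (T : ∀ I J, G I →+ G J)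

/-- The sign of `e_i ∧ e_{I - i}` with respect to `e_I`. -/
def cubeSign (i : Fin n) (I : Finset (Fin n)) : ℤ := (-1) ^ (I.filter (· < i)).card

theorem cubeSign_mul_self (i : Fin n) (I : Finset (Fin n)) : cubeSign i I * cubeSign i I = 1 := by
  rw [cubeSign, ← pow_add, ← two_mul, pow_mul, neg_one_sq, one_pow]

theorem cubeSign_erase_of_lt {i j : Fin n} {I : Finset (Fin n)} (hi : i ∈ I) (hij : i < j) :
    cubeSign j (I.erase i) = -cubeSign j I := by
  have hm : i ∈ I.filter (· < j) := Finset.mem_filter.2 ⟨hi, hij⟩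
  rw [cubeSign, cubeSign, Finset.filter_erase, ← Finset.card_erase_add_one hm, pow_succ]
  ring

theorem cubeSign_erase_of_gt {i j : Fin n} {I : Finset (Fin n)} (hij : i < j) :
    cubeSign i (I.erase j) = cubeSign i I := by
  rw [cubeSign, cubeSign, Finset.filter_erase, Finset.erase_eq_of_notMem]
  simp [hij.le]

theorem cubeSign_swap {i j : Fin n} {I : Finset (Fin n)} (hi : i ∈ I) (hj : j ∈ I) (hij : i ≠ j) :
    cubeSign i I * cubeSign j (I.erase i) = -(cubeSign j I * cubeSign i (I.erase j)) := by
  rcases lt_or_gt_of_ne hij with h | h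
  · rw [cubeSign_erase_of_lt hi h, cubeSign_erase_of_gt h]
    ring
  · rw [cubeSign_erase_of_lt hj h, cubeSign_erase_of_gt h]
    ring

/-- The differential of the total complex of the cube with vertices `G I` and with maps `T I J`. -/
def cubeTotal (c : ∀ I, G I) (I : Finset (Fin n)) : G I :=
  ∑ i ∈ I, cubeSign i I • T (I.erase i) I (c (I.erase i))

theorem cubeTotal_cubeTotal
    (hT : ∀ I J L, I ⊆ J → J ⊆ L → ∀ x, T J L (T I J x) = T I L x) (c : ∀ I, G I)
    (I : Finset (Fin n)) : cubeTotal T (cubeTotal T c) I = 0 := by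
  have h1 : cubeTotal T (cubeTotal T c) I = ∑ i ∈ I, ∑ j ∈ I.erase i,
      (cubeSign i I * cubeSign j (I.erase i)) •
        T ((I.erase i).erase j) I (c ((I.erase i).erase j)) := by
    refine Finset.sum_congr rfl fun i _ => ?_
    rw [cubeTotal, map_sum, Finset.smul_sum]
    refine Finset.sum_congr rfl fun j _ => ?_
    rw [map_zsmul, hT _ _ _ (Finset.erase_subset _ _) (Finset.erase_subset _ _), mul_smul]
  rw [h1, Finset.sum_sigma']
  refine Finset.sum_involution (fun x _ => ⟨x.2, x.1⟩) ?_ ?_ ?_ ?_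
  · rintro ⟨i, j⟩ hx
    obtain ⟨hi, hj⟩ := Finset.mem_sigma.1 hx
    obtain ⟨hji, hj⟩ := Finset.mem_erase.1 hj
    change (cubeSign i I * cubeSign j (I.erase i)) •
        T ((I.erase i).erase j) I (c ((I.erase i).erase j)) +
      (cubeSign j I * cubeSign i (I.erase j)) •
        T ((I.erase j).erase i) I (c ((I.erase j).erase i)) = 0
    rw [cubeSign_swap hi hj (Ne.symm hji), Finset.erase_right_comm, neg_smul, neg_add_cancel]
  · rintro ⟨i, j⟩ hx _ h
    obtain ⟨-, hj⟩ := Finset.mem_sigma.1 hx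
    exact (Finset.mem_erase.1 hj).1 (congrArg Sigma.fst h)
  · rintro ⟨i, j⟩ hx
    obtain ⟨hi, hj⟩ := Finset.mem_sigma.1 hx
    obtain ⟨hji, hj⟩ := Finset.mem_erase.1 hj
    exact Finset.mem_sigma.2 ⟨hj, Finset.mem_erase.2 ⟨Ne.symm hji, hi⟩⟩
  · rintro ⟨i, j⟩ _
    rfl

theorem cubeTotal_sub (c c' : ∀ I, G I) (I : Finset (Fin n)) :
    cubeTotal T (fun J => c J - c' J) I = cubeTotal T c I - cubeTotal T c' I := by
  simp only [cubeTotal, map_sub, smul_sub, Finset.sum_sub_distrib]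

/-- The total complex of a cube is exact as soon as all the maps in one direction are bijective. -/
theorem exists_cubeTotal_eq
    (hT : ∀ I J L, I ⊆ J → J ⊆ L → ∀ x, T J L (T I J x) = T I L x) (k : Fin n)
    (hk : ∀ I, k ∉ I → Function.Bijective (T I (insert k I))) (c : ∀ I, G I)
    (hc : ∀ I, cubeTotal T c I = 0) : ∃ b : ∀ I, G I, ∀ I, cubeTotal T b I = c I := by
  classical
  let b : ∀ I, G I := fun I => if h : k ∉ I then
    ((hk I h).2 (cubeSign k (insert k I) • c (insert k I))).choose else 0
  have hb0 : ∀ I, k ∈ I → b I = 0 := fun I h => dif_neg (not_not.2 h)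
  have hb1 : ∀ I, k ∉ I → T I (insert k I) (b I) = cubeSign k (insert k I) • c (insert k I) := by
    intro I h
    simp only [b, dif_pos h]
    exact ((hk I h).2 (cubeSign k (insert k I) • c (insert k I))).choose_spec
  have hin : ∀ I, k ∉ I → cubeTotal T b (insert k I) = c (insert k I) := by
    intro I h
    rw [cubeTotal, Finset.sum_insert h, Finset.erase_insert h, hb1 I h, smul_smul,
      cubeSign_mul_self, one_smul, add_eq_left]
    refine Finset.sum_eq_zero fun i hi => ?_
    rw [hb0 _ (Finset.mem_erase.2 ⟨fun h' => h (h' ▸ hi), Finset.mem_insert_self _ _⟩), map_zero,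
      smul_zero]
  refine ⟨b, fun I => ?_⟩
  by_cases h : k ∈ I
  · rw [← Finset.insert_erase h]
    exact hin _ (Finset.notMem_erase _ _)
  · -- the cocycle `c - d b` vanishes at the vertices that contain `k`, hence everywhere
    have h1 : cubeTotal T (fun J => c J - cubeTotal T b J) (insert k I) = 0 := by
      rw [cubeTotal_sub, hc, cubeTotal_cubeTotal T hT, sub_zero]
    rw [cubeTotal, Finset.sum_insert h, Finset.erase_insert h, Finset.sum_eq_zero, add_zero] at h1
    · have h2 := congrArg (cubeSign k (insert k I) • ·) h1
      simp only [smul_smul, cubeSign_mul_self, one_smul, smul_zero] at h2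
      exact (sub_eq_zero.1 ((injective_iff_map_eq_zero _).1 (hk I h).1 _ h2)).symm
    · intro i hi
      have hki : k ∈ (insert k I).erase i :=
        Finset.mem_erase.2 ⟨fun h' => h (h' ▸ hi), Finset.mem_insert_self _ _⟩
      have h3 := hin _ (Finset.notMem_erase k ((insert k I).erase i))
      rw [Finset.insert_erase hki] at h3
      rw [h3, sub_self, map_zero, smul_zero]

/-- The differential of the total complex of a cube, in degree `m`. -/
def cubeDiff (m : ℕ) (c : ∀ I : {I : Finset (Fin n) // I.card = m}, G I.1)
    (I : {I : Finset (Fin n) // I.card = m + 1}) : G I.1 :=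
  ∑ i ∈ I.1.attach, (-1 : ℤ) ^ (I.1.filter (· < i.1)).card • T (I.1.erase i.1) I.1
    (c ⟨I.1.erase i.1, by rw [Finset.card_erase_of_mem i.2, I.2, Nat.add_sub_cancel]⟩)

/-- The extension by zero of a cochain of degree `m`. -/
def cubeExtend {m : ℕ} (c : ∀ I : {I : Finset (Fin n) // I.card = m}, G I.1)
    (I : Finset (Fin n)) : G I :=
  if h : I.card = m then c ⟨I, h⟩ else 0

theorem cubeDiff_restrict (m : ℕ) (c : ∀ I, G I) (I : {I : Finset (Fin n) // I.card = m + 1}) :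
    cubeDiff T m (fun J => c J.1) I = cubeTotal T c I.1 :=
  Finset.sum_attach I.1 fun i => cubeSign i I.1 • T (I.1.erase i) I.1 (c (I.1.erase i))

theorem cubeExtend_apply {m : ℕ} (c : ∀ I : {I : Finset (Fin n) // I.card = m}, G I.1)
    (I : {I : Finset (Fin n) // I.card = m}) : cubeExtend c I.1 = c I := dif_pos I.2

theorem cubeTotal_cubeExtend (m : ℕ) (c : ∀ I : {I : Finset (Fin n) // I.card = m}, G I.1)
    (I : Finset (Fin n)) : cubeTotal T (cubeExtend c) I = cubeExtend (cubeDiff T m c) I := by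
  by_cases h : I.card = m + 1
  · have h1 := cubeDiff_restrict T m (cubeExtend c) ⟨I, h⟩
    rw [← h1, cubeExtend, dif_pos h]
    congr 1
    exact funext fun J => cubeExtend_apply c J
  · rw [cubeExtend, dif_neg h]
    refine Finset.sum_eq_zero fun i hi => ?_
    rw [cubeExtend, dif_neg, map_zero, smul_zero]
    intro h'
    exact h (by rw [← Finset.card_erase_add_one hi, h'])

theorem cubeDiff_cubeDiff
    (hT : ∀ I J L, I ⊆ J → J ⊆ L → ∀ x, T J L (T I J x) = T I L x) (m : ℕ)
    (c : ∀ I : {I : Finset (Fin n) // I.card = m}, G I.1) :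
    cubeDiff T (m + 1) (cubeDiff T m c) = 0 := by
  funext I
  have h := cubeTotal_cubeTotal T hT (cubeExtend c) I.1
  rw [show cubeTotal T (cubeExtend c) = cubeExtend (cubeDiff T m c) from
    funext fun J => cubeTotal_cubeExtend T m c J, cubeTotal_cubeExtend, cubeExtend_apply] at h
  exact h

theorem cubeTotal_cubeExtend_eq_zero {m : ℕ}
    {c : ∀ I : {I : Finset (Fin n) // I.card = m}, G I.1} (hc : cubeDiff T m c = 0)
    (I : Finset (Fin n)) : cubeTotal T (cubeExtend c) I = 0 := by
  rw [cubeTotal_cubeExtend, hc, cubeExtend]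
  split_ifs <;> rfl

theorem cubeDiff_zero_injective
    (hT : ∀ I J L, I ⊆ J → J ⊆ L → ∀ x, T J L (T I J x) = T I L x) (k : Fin n)
    (hk : ∀ I, k ∉ I → Function.Bijective (T I (insert k I)))
    {c : ∀ I : {I : Finset (Fin n) // I.card = 0}, G I.1} (hc : cubeDiff T 0 c = 0) : c = 0 := by
  obtain ⟨b, hb⟩ := exists_cubeTotal_eq T hT k hk _ (cubeTotal_cubeExtend_eq_zero T hc)
  funext ⟨I, hI⟩
  obtain rfl := Finset.card_eq_zero.1 hI
  rw [← cubeExtend_apply c, ← hb, cubeTotal, Finset.sum_empty]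
  rfl

theorem exists_cubeDiff_eq
    (hT : ∀ I J L, I ⊆ J → J ⊆ L → ∀ x, T J L (T I J x) = T I L x) (k : Fin n)
    (hk : ∀ I, k ∉ I → Function.Bijective (T I (insert k I))) {m : ℕ}
    {c : ∀ I : {I : Finset (Fin n) // I.card = m + 1}, G I.1} (hc : cubeDiff T (m + 1) c = 0) :
    ∃ b, cubeDiff T m b = c := by
  obtain ⟨b, hb⟩ := exists_cubeTotal_eq T hT k hk _ (cubeTotal_cubeExtend_eq_zero T hc)
  refine ⟨fun J => b J.1, funext fun I => ?_⟩
  rw [cubeDiff_restrict, hb, cubeExtend_apply]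

end Cube

/-! ### The transfer factors on sections of the completions -/

section Composition

variable (K : Type) [Field K]
variable {ι X Y : Type u} [AddCommGroup X] [AddCommGroup Y] {P : RootDatum ι X Y}
variable [Finite ι] (v : ι → ℕ) (Φp : Set ι) {H H' H'' : Set ι}

omit [Finite ι] in
theorem derProd_union [DecidableEq ι] {S S' : Finset ι} (h : Disjoint S S') :
    derProd K P v (S ∪ S') = derProd K P v S * derProd K P v S' :=
  Finset.noncommProd_union_of_disjoint h _ _

theorem transfer_mul_transfer (h : H' ⊆ H) (h' : H'' ⊆ H') :
    transfer K P v Φp H' H'' * transfer K P v Φp H H' = transfer K P v Φp H H'' := by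
  classical
  rw [transfer_eq_derProd, transfer_eq_derProd, transfer_eq_derProd, ← derProd_union]
  · congr 1
    ext i
    simp only [Finset.mem_union, mem_rootDiff]
    have h1 := @h i
    have h2 := @h' i
    tauto
  · refine Finset.disjoint_left.2 fun i hi hi' => ?_
    exact (mem_rootDiff.1 hi').2.2 (mem_rootDiff.1 hi).2.1

variable [Module.Free ℤ X] {ΦM : Set ι} (pr : Y →ₗ[ℤ] XS P ΦM)

theorem transferLH_transferLH (h : H' ⊆ H) (h' : H'' ⊆ H') (x : LH K pr v Φp H) :
    transferLH K pr v Φp H' H'' (transferLH K pr v Φp H H' x) = transferLH K pr v Φp H H'' x := by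
  obtain ⟨x, hx⟩ := x
  obtain ⟨t, rfl⟩ := Submodule.Quotient.mk_surjective _ x
  refine Subtype.ext (congrArg Submodule.Quotient.mk ?_)
  rw [← transfer_mul_transfer K v Φp h h', Module.End.mul_eq_comp, LinearMap.baseChange_comp]
  rfl

end Composition

section Sections

variable {K : Type} [Field K]
variable {ι X Y : Type u} [AddCommGroup X] [AddCommGroup Y] {P : RootDatum ι X Y} {ΦM : Set ι}
variable {M M' M'' : Type u} [AddCommGroup M] [Module (Cox K P ΦM) M]
variable [AddCommGroup M'] [Module (Cox K P ΦM) M'] [AddCommGroup M''] [Module (Cox K P ΦM) M'']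
variable {gr : ClassGp P ΦM → AddSubgroup M} [SetLike.GradedSMul (coxGrading K P ΦM) gr]
variable {gr' : ClassGp P ΦM → AddSubgroup M'} [SetLike.GradedSMul (coxGrading K P ΦM) gr']
variable {gr'' : ClassGp P ΦM → AddSubgroup M''} [SetLike.GradedSMul (coxGrading K P ΦM) gr'']
variable (sM : Multiplicative (XS P ΦM) →* Kˣ) (c : ClassGp P ΦM)

theorem truncMap_truncMap (n : ℕ) (σ : fan P ΦM) {g : M →ₗ[Cox K P ΦM] M'}
    {g' : M' →ₗ[Cox K P ΦM] M''} {g'' : M →ₗ[Cox K P ΦM] M''}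
    (hg : ∀ e, ∀ m ∈ gr e, g m ∈ gr' e) (hg' : ∀ e, ∀ m ∈ gr' e, g' m ∈ gr'' e)
    (hg'' : ∀ e, ∀ m ∈ gr e, g'' m ∈ gr'' e) (h : ∀ x, g' (g x) = g'' x)
    (x : Trunc gr sM c n σ) :
    truncMap sM c n σ g' hg' (truncMap sM c n σ g hg x) = truncMap sM c n σ g'' hg'' x := by
  obtain ⟨⟨_, e, f, hf, m, hm, rfl⟩, rfl⟩ := Submodule.Quotient.mk_surjective _ x
  refine congrArg Submodule.Quotient.mk (Subtype.ext ?_)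
  change LocalizedModule.map (denoms K σ) g' (LocalizedModule.map (denoms K σ) g
    (LocalizedModule.mk m f)) = LocalizedModule.map (denoms K σ) g'' (LocalizedModule.mk m f)
  rw [LocalizedModule.map_mk, LocalizedModule.map_mk, LocalizedModule.map_mk, h]

open StructureSheaf in
theorem comapₗ_comapₗ {R N N' N'' : Type u} [CommRing R] [AddCommGroup N] [Module R N]
    [AddCommGroup N'] [Module R N'] [AddCommGroup N''] [Module R N''] {f : N →ₗ[R] N'}
    {f' : N' →ₗ[R] N''} {f'' : N →ₗ[R] N''} (h : ∀ x, f' (f x) = f'' x)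
    (U : Opens (PrimeSpectrum.Top R)) (s : (structureSheafInType R N).obj.obj (op U)) :
    comapₗ f' U U (fun _ h => h) (comapₗ f U U (fun _ h => h) s) =
      comapₗ f'' U U (fun _ h => h) s := by
  refine Subtype.ext (funext fun p => ?_)
  obtain ⟨a, b, hab⟩ : ∃ (a : N) (b : p.1.asIdeal.primeCompl), s.1 p = LocalizedModule.mk a b := by
    generalize s.1 p = z
    induction z using LocalizedModule.induction_on with
    | h m s => exact ⟨m, s, rfl⟩
  have h1 := comapₗ_apply_of_eq_mk f' U _ p _ _ (comapₗ_apply_of_eq_mk f U s p a b hab)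
  rw [h] at h1
  exact h1.trans (comapₗ_apply_of_eq_mk f'' U s p a b hab).symm

theorem completedMap_completedMap (W : Opens (toricVariety K P ΦM)) {g : M →ₗ[Cox K P ΦM] M'}
    {g' : M' →ₗ[Cox K P ΦM] M''} {g'' : M →ₗ[Cox K P ΦM] M''}
    (hg : ∀ e, ∀ m ∈ gr e, g m ∈ gr' e) (hg' : ∀ e, ∀ m ∈ gr' e, g' m ∈ gr'' e)
    (hg'' : ∀ e, ∀ m ∈ gr e, g'' m ∈ gr'' e) (h : ∀ x, g' (g x) = g'' x)
    (s : completedSections gr sM c W) :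
    completedMap sM c W g' hg' (completedMap sM c W g hg s) = completedMap sM c W g'' hg'' s :=
  Subtype.ext (funext fun n => funext fun σ =>
    comapₗ_comapₗ (truncMap_truncMap sM c n σ hg hg' hg'' h) _ (s.1 n σ))

theorem completedRestrict_apply {W' W : Opens (toricVariety K P ΦM)} (h : W' ≤ W)
    (s : completedSections gr sM c W) (n : ℕ) (σ : fan P ΦM) (p : chartOpen K W' σ) :
    ((completedRestrict gr sM c h s).1 n σ).1 p = (s.1 n σ).1 ⟨p.1, h p.2⟩ := rfl

/-- A section that vanishes locally on the toric variety is zero. -/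
theorem completedSections_eq_zero_of_locally {W : Opens (toricVariety K P ΦM)}
    (s : completedSections gr sM c W)
    (hs : ∀ y ∈ W, ∃ W', ∃ h : W' ≤ W, y ∈ W' ∧ completedRestrict gr sM c h s = 0) : s = 0 := by
  refine Subtype.ext (funext fun n => funext fun σ => Subtype.ext (funext fun p => ?_))
  obtain ⟨W', h, hy, h0⟩ := hs _ p.2
  have h1 := completedRestrict_apply sM c h s n σ ⟨p.1, hy⟩
  rw [h0] at h1
  exact h1.symm

theorem completedMap_bijective {W : Opens (toricVariety K P ΦM)} {g : M →ₗ[Cox K P ΦM] M'}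
    (hg : ∀ e, ∀ m ∈ gr e, g m ∈ gr' e)
    (h : ∀ n σ, ∀ p ∈ chartOpen K W σ, InvertibleAt (truncMap sM c n σ g hg) p) :
    Function.Bijective (completedMap sM c W g hg) := by
  have hb : ∀ n σ, Function.Bijective (sectMap sM c W n σ g hg) := fun n σ =>
    comapₗ_bijective_of_invertibleAt (h n σ)
  constructor
  · intro s t hst
    exact Subtype.ext (funext fun n => funext fun σ => (hb n σ).1
      (congrFun (congrFun (congrArg Subtype.val hst) n) σ))
  · intro s'
    choose s hs using fun n σ => (hb n σ).2 (s'.1 n σ)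
    refine ⟨⟨s, fun n σ => (hb n σ).1 ?_, fun n τ σ hτ => (hb n τ).1 ?_⟩,
      Subtype.ext (funext fun n => funext fun σ => hs n σ)⟩
    · have h1 := comap_square (truncMap sM c (n + 1) σ g hg) (truncMap sM c n σ g hg)
        (truncStep gr sM c n σ) (truncStep gr' sM c n σ) (truncMap_step sM c n σ g hg)
        _ _ (fun _ h => h) (s (n + 1) σ)
      refine h1.symm.trans (Eq.trans (congrArg _ (hs (n + 1) σ)) ?_)
      exact (s'.2.1 n σ).trans (hs n σ).symm
    · have h1 := comap_square (truncMap sM c n σ g hg) (truncMap sM c n τ g hg)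
        (truncRes gr sM c n hτ) (truncRes gr' sM c n hτ) (truncMap_res sM c n hτ g hg)
        _ _ (chartOpen_subset K W hτ) (s n σ)
      refine h1.symm.trans (Eq.trans (congrArg _ (hs n σ)) ?_)
      exact (s'.2.2 n τ σ hτ).trans (hs n τ).symm

end Sections

section Complex

variable {K : Type} [Field K]
variable {ι X Y : Type u} [AddCommGroup X] [AddCommGroup Y] {P : RootDatum ι X Y} {ΦM : Set ι}
variable {sM : Multiplicative (XS P ΦM) →* Kˣ} {n : ℕ} (e : Fin n ≃ maximalCentralizers sM)
variable [Finite ι] [Module.Free ℤ X] (pr : Y →ₗ[ℤ] XS P ΦM) (v : ι → ℕ) (Φp : Set ι)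
variable (D : Ray P ΦM → ℤ)

omit [Finite ι] [Module.Free ℤ X] in
theorem groupRoots_anti {I J : Finset (Fin n)} (h : I ⊆ J) : groupRoots e J ⊆ groupRoots e I :=
  fun _ hi j hj => hi j (h hj)

theorem transferHat_transferHat {H H' H'' : Set ι} (h : H' ⊆ H) (h' : H'' ⊆ H')
    (W : Opens (toricVariety K P ΦM)) (s : FHat sM pr v Φp D H W) :
    transferHat sM pr v Φp D H' H'' W (transferHat sM pr v Φp D H H' W s) =
      transferHat sM pr v Φp D H H'' W s :=
  completedMap_completedMap sM _ W _ _ _ (transferLH_transferLH K v Φp pr h h') s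

variable {Φp}

theorem transferHat_bijective [CharZero K] [P.IsReduced] (hΦp : IsHalfSystem P Φp)
    {H H' Ψ : Set ι} (hH : H' ⊆ H) (hΨ : H ∩ Ψ ⊆ H') {W : Opens (toricVariety K P ΦM)}
    (hW : W ≤ goodOpens pr sM Ψ) : Function.Bijective (transferHat sM pr v Φp D H H' W) :=
  completedMap_bijective sM _ _ fun n _ p hp => invertibleAt_truncMap pr sM v hΦp hH hΨ _ n
    ((chartIncl_mem_goodOpens pr sM Ψ p).1 (hW hp))

variable (Φp) in
/-- The maps of the cube whose total complex is the complex of transfer factors: `differential` is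
`cubeDiff` of this cube, by definition. -/
def cubeTransfer (W : Opens (toricVariety K P ΦM)) (I J : Finset (Fin n)) :
    FHat sM pr v Φp D (groupRoots e I) W →+ FHat sM pr v Φp D (groupRoots e J) W :=
  transferHat sM pr v Φp D (groupRoots e I) (groupRoots e J) W

theorem cubeTransfer_cubeTransfer (W : Opens (toricVariety K P ΦM)) (I J L : Finset (Fin n))
    (h : I ⊆ J) (h' : J ⊆ L) (x : FHat sM pr v Φp D (groupRoots e I) W) :
    cubeTransfer e pr v Φp D W J L (cubeTransfer e pr v Φp D W I J x) =
      cubeTransfer e pr v Φp D W I L x :=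
  transferHat_transferHat pr v Φp D (groupRoots_anti e h) (groupRoots_anti e h') W x

theorem cubeTransfer_bijective [CharZero K] [P.IsReduced] (hΦp : IsHalfSystem P Φp) (i : Fin n)
    {W : Opens (toricVariety K P ΦM)} (hW : W ≤ goodOpens pr sM (e i).1) (I : Finset (Fin n)) :
    Function.Bijective (cubeTransfer e pr v Φp D W I (insert i I)) := by
  refine transferHat_bijective pr v D hΦp (groupRoots_anti e (Finset.subset_insert _ _)) ?_ hW
  rintro j ⟨hj, hj'⟩ k hk
  rcases Finset.mem_insert.1 hk with rfl | hk
  · exact hj'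
  · exact hj k hk

theorem differential_cochainRestrict {W' W : Opens (toricVariety K P ΦM)} (h : W' ≤ W) (m : ℕ)
    (c : Cochain e pr v Φp D W m) :
    differential e pr v Φp D W' m (cochainRestrict e pr v Φp D h m c) =
      cochainRestrict e pr v Φp D h (m + 1) (differential e pr v Φp D W m c) := by
  let r (H : Set ι) : FHat sM pr v Φp D H W →+ FHat sM pr v Φp D H W' := completedRestrict _ sM _ h
  have hr (H H' : Set ι) (x : FHat sM pr v Φp D H W) :
      r H' (transferHat sM pr v Φp D H H' W x) = transferHat sM pr v Φp D H H' W' (r H x) := rfl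
  funext I
  refine Eq.trans ?_ (map_sum (r (groupRoots e I.1)) _ _).symm
  refine Finset.sum_congr rfl fun i _ => Eq.symm ?_
  exact (map_zsmul (r (groupRoots e I.1)) _ (transferHat sM pr v Φp D _ _ W _)).trans
    (congrArg _ (hr _ _ _))

theorem exists_mem_goodOpens_fin [IsAlgClosed K] (hpr : ∀ x : XS P ΦM, pr (x : Y) = x)
    (y : toricVariety K P ΦM) : ∃ i : Fin n, y ∈ goodOpens pr sM (e i).1 := by
  obtain ⟨Ψ, hΨ, hy⟩ := exists_mem_goodOpens pr sM hpr y
  exact ⟨e.symm ⟨Ψ, hΨ⟩, by rwa [e.apply_symm_apply]⟩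

theorem cochain_eq_zero_of_locally (W : Opens (toricVariety K P ΦM)) (m : ℕ)
    (c : Cochain e pr v Φp D W m)
    (hc : ∀ y ∈ W, ∃ W', ∃ h : W' ≤ W, y ∈ W' ∧ cochainRestrict e pr v Φp D h m c = 0) :
    c = 0 := by
  funext I
  have hz : (0 : Cochain e pr v Φp D W m) I = (0 : FHat sM pr v Φp D (groupRoots e I.1) W) := rfl
  refine Eq.trans ?_ hz.symm
  have key : ∀ y ∈ W, ∃ W', ∃ h : W' ≤ W, y ∈ W' ∧ completedRestrict
    (gradedPiece K pr v Φp (groupRoots e I.1)) sM (Submodule.Quotient.mk D) h (c I) = 0 := by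
    exact fun y hy => (hc y hy).imp fun W' => Exists.imp fun h => And.imp_right fun h0 =>
      congrFun h0 I
  exact completedSections_eq_zero_of_locally (gr := gradedPiece K pr v Φp (groupRoots e I.1)) sM
    (Submodule.Quotient.mk D) (c I) key

end Complex

end TransferComplex

end

theorem mainTheorem5 {ι X Y : Type u} [Finite ι]
    [AddCommGroup X] [Module.Free ℤ X] [Module.Finite ℤ X]
    [AddCommGroup Y] [Module.Free ℤ Y] [Module.Finite ℤ Y]
    (P : RootDatum ι X Y) [P.IsReduced]
    (Φp : Set ι) (hΦp : TransferComplex.IsHalfSystem P Φp)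
    (ΦM : Set ι) (hΦM : TransferComplex.IsLevi P ΦM)
    (pr : Y →ₗ[ℤ] TransferComplex.XS P ΦM) (hpr : ∀ x : TransferComplex.XS P ΦM, pr (x : Y) = x)
    {k : Type*} [Field k] (γ : Y ⊗[ℤ] LaurentSeries k)
    (hγ : ∀ i, TransferComplex.rootValue P γ i ≠ 0 ∧
      0 ≤ HahnSeries.order (TransferComplex.rootValue P γ i))
    (ℓ : ℕ) [Fact ℓ.Prime]
    (sM : Multiplicative (TransferComplex.XS P ΦM) →* (AlgebraicClosure ℚ_[ℓ])ˣ)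
    (D : TransferComplex.Ray P ΦM → ℤ)
    (n : ℕ) (e : Fin n ≃ TransferComplex.maximalCentralizers sM) :
    (∀ W m (c : TransferComplex.Cochain e pr (TransferComplex.rootVal P γ) Φp D W m),
      TransferComplex.differential e pr (TransferComplex.rootVal P γ) Φp D W (m + 1)
        (TransferComplex.differential e pr (TransferComplex.rootVal P γ) Φp D W m c) = 0) ∧
    (∀ W (c : TransferComplex.Cochain e pr (TransferComplex.rootVal P γ) Φp D W 0),
      TransferComplex.differential e pr (TransferComplex.rootVal P γ) Φp D W 0 c = 0 → c = 0) ∧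
    (∀ W m (c : TransferComplex.Cochain e pr (TransferComplex.rootVal P γ) Φp D W (m + 1)),
      TransferComplex.differential e pr (TransferComplex.rootVal P γ) Φp D W (m + 1) c = 0 →
      ∀ y ∈ W, ∃ W', ∃ h : W' ≤ W, y ∈ W' ∧
        ∃ b : TransferComplex.Cochain e pr (TransferComplex.rootVal P γ) Φp D W' m,
          TransferComplex.differential e pr (TransferComplex.rootVal P γ) Φp D W' m b =
            TransferComplex.cochainRestrict e pr (TransferComplex.rootVal P γ) Φp D h (m + 1) c) := by
  have : CharZero (AlgebraicClosure ℚ_[ℓ]) := charZero_of_injective_algebraMap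
    (algebraMap ℚ_[ℓ] (AlgebraicClosure ℚ_[ℓ])).injective
  refine ⟨fun W m c => ?_, fun W c hc => ?_, fun W m c hc y hy => ?_⟩
  · exact TransferComplex.cubeDiff_cubeDiff _
      (TransferComplex.cubeTransfer_cubeTransfer e pr _ D W) m c
  · refine TransferComplex.cochain_eq_zero_of_locally e pr _ D W 0 c fun y hy => ?_
    obtain ⟨i, hi⟩ := TransferComplex.exists_mem_goodOpens_fin e pr hpr y
    refine ⟨W ⊓ TransferComplex.goodOpens pr sM (e i).1, inf_le_left, ⟨hy, hi⟩, ?_⟩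
    refine TransferComplex.cubeDiff_zero_injective _
      (TransferComplex.cubeTransfer_cubeTransfer e pr _ D _) i
      (fun I _ => TransferComplex.cubeTransfer_bijective e pr _ D hΦp i inf_le_right I) ?_
    refine (TransferComplex.differential_cochainRestrict e pr _ D inf_le_left 0 c).trans ?_
    rw [hc]
    rfl
  · obtain ⟨i, hi⟩ := TransferComplex.exists_mem_goodOpens_fin e pr hpr y
    refine ⟨W ⊓ TransferComplex.goodOpens pr sM (e i).1, inf_le_left, ⟨hy, hi⟩, ?_⟩
    refine TransferComplex.exists_cubeDiff_eq _
      (TransferComplex.cubeTransfer_cubeTransfer e pr _ D _) i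
      (fun I _ => TransferComplex.cubeTransfer_bijective e pr _ D hΦp i inf_le_right I) ?_
    refine (TransferComplex.differential_cochainRestrict e pr _ D inf_le_left (m + 1) c).trans ?_
    rw [hc]
    rfl
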